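/- Let $n\ge 1$, let $\mathbb H$ be the quaternions, $\mathcal Q\subset\mathbb H$ the imaginary quaternions, and $\langle\mathbf a,\mathbf b\rangle=\mathbf a\,\overline{\mathbf b}^{\,t}$ for row vectors $\mathbf a,\mathbf b\in\mathbb H^{n-1}$ (and $\langle \mathrm a,\mathrm b\rangle=\mathrm a\overline{\mathrm b}$ for scalars). For $\mathrm a,\mathrm b\in\mathcal Q$ put $C(\mathrm a,\mathrm b)=\mathrm a\mathrm b-\mathrm b\mathrm a$, $A(\mathrm a,\mathrm b)=\mathrm a\mathrm b+\mathrm b\mathrm a$; for $\mathbf a,\mathbf b\in\mathbb H^{n-1}$ put $C(\mathbf a,\mathbf b)=\langle\mathbf a,\mathbf b\rangle-\langle\mathbf b,\mathbf a\rangle$, $A(\mathbf a,\mathbf b)=\langle\mathbf a,\mathbf b\rangle+\langle\mathbf b,\mathbf a\rangle$, $\mathbf C(\mathbf a,\mathbf b)=\overline{\mathbf a}^{\,t}\mathbf b-\overline{\mathbf b}^{\,t}\mathbf a$. Let $J^\infty=(x,\mathrm u,\mathbf u,\mathrm u_x,\mathbf u_x,\dots)$ be the $x$-jet space of $\mathrm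 u\in\mathcal Q$, $\mathbf u\in\mathbb H^{n-1}$. A function on $J^\infty$ is a smooth function of $x$ and finitely many of the jet variables; $D_x$ is the total $x$-derivative. On the total $x$-derivatives of such functions, $D_x^{-1}$ is the inverse of $D_x$ with vanishing constant of integration (i.e. $D_x^{-1}f$ vanishes at the point $x=0$, $\mathrm u_{(k)}=0$, $\mathbf u_{(k)}=0$ for all $k$). A functional $\mathfrak G=\int G\,dx$ is a real function $G$ on $J^\infty$ modulo total $x$-derivatives. An evolutionary vector field $\mathrm X=\mathrm h\cdot\partial/\partial\mathrm u+\mathrm{Re}(\mathbf h\cdot\partial/\partial\mathbf u)$, given by functions $\mathrm h\in\mathcal Q$, $\mathbf h\in\mathbb H^{n-1}$ on $J^\infty$, acts on functions and functionals through its prolongation. The variational derivatives of $\mathfrak G$ are defined by $$\int \mathrm{pr}(\mathrm X)G\,dx=\mathrm{Re}\int\big(\langle\mathrm h,-\delta\mathfrak G/\delta\mathrm u\rangle+\langle\mathbf h,\delta\mathfrak G/\delta\overline{\mathbf u}\rangle\big)dx\quad\text{for all }(\mathrm h,\mathbf h),$$ and $\delta\mathfrak G$ denotes the pair $(-\delta\mathfrak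 G/\delta\mathrm u,\ \delta\mathfrak G/\delta\overline{\mathbf u})$. Define the operators $$\mathcal H\begin{pmatrix}\mathrm w\\\mathbf w\end{pmatrix}=\begin{pmatrix}D_x\mathrm w+C(\mathrm u,\mathrm w^\parallel)+\tfrac12C(\mathbf u,\mathbf w)\\ D_x\mathbf w-\mathrm w^\parallel\mathbf u+\mathbf u\mathbf W^\parallel+\mathrm w\mathbf u-\mathrm u\mathbf w\end{pmatrix},\quad \mathrm w^\parallel=-D_x^{-1}\big(C(\mathrm u,\mathrm w)-\tfrac12C(\mathbf u,\mathbf w)\big),\ \ \mathbf W^\parallel=D_x^{-1}\mathbf C(\mathbf u,\mathbf w),$$ $$\mathcal J\begin{pmatrix}\mathrm h\\\mathbf h\end{pmatrix}=\begin{pmatrix}\tfrac14D_x\mathrm h+\tfrac14C(\mathbf u,\mathbf h)+\mathrm h_\parallel\mathrm u\\ D_x\mathbf h+\tfrac12\mathrm h\mathbf u+\mathrm u\mathbf h+\mathrm h_\parallel\mathbf u\end{pmatrix},\quad \mathrm h_\parallel=D_x^{-1}\big(-\tfrac12A(\mathrm u,\mathrm h)+\tfrac12A(\mathbf u,\mathbf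 h)\big),$$ the recursion operator $\mathcal R=\mathcal H\mathcal J$ and $\mathcal R^*=\mathcal J\mathcal H$, the Poisson bracket $\{\mathfrak G_1,\mathfrak G_2\}=\mathrm{Re}\int\langle\delta\mathfrak G_1,\mathcal H\,\delta\mathfrak G_2\rangle dx$, and the symplectic $2$-form $\boldsymbol\omega(\mathrm X_1,\mathrm X_2)=\mathrm{Re}\int\langle\mathrm X_1(\mathrm u,\mathbf u),\mathcal J\,\mathrm X_2(\mathrm u,\mathbf u)\rangle dx$ (in both, $\langle\cdot,\cdot\rangle$ is the sum of the scalar and the vector inner products). For $l=0,1,2,\dots$ let $$\begin{pmatrix}\mathrm h_{(l)}\\\mathbf h_{(l)}\end{pmatrix}=\mathcal R^l\begin{pmatrix}\mathrm u_x\\\mathbf u_x\end{pmatrix},\qquad \begin{pmatrix}\mathrm w_{(l)}\\\mathbf w_{(l)}\end{pmatrix}=\mathcal R^{*l}\begin{pmatrix}\mathrm u\\\mathbf u\end{pmatrix},\qquad H^{(l)}=\frac1{1+2l}D_x^{-1}\mathrm{Re}\big(\langle\mathrm u,\mathrm h_{(l)}\rangle+\langle\mathbf u,\mathbf h_{(l)}\rangle\big).$$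 Theorem. $\mathcal R^*$ is the formal adjoint of $\mathcal R$ (on arguments for which all the inverses $D_x^{-1}$ exist), and for all $k,l\ge0$: 1. Every $D_x^{-1}$ occurring in these definitions is applied to a total $x$-derivative, so that $(\mathrm h_{(l)},\mathbf h_{(l)})$, $(\mathrm w_{(l)},\mathbf w_{(l)})$ and $H^{(l)}$ are functions on $J^\infty$. 2. The evolutionary vector fields $\mathrm X_{(l)}=\mathrm h_{(l)}\cdot\partial/\partial\mathrm u+\mathrm{Re}(\mathbf h_{(l)}\cdot\partial/\partial\mathbf u)$ commute: $[\mathrm X_{(k)},\mathrm X_{(l)}]=0$. 3. They are Hamiltonian with Hamiltonians $\mathfrak H^{(l)}=\int H^{(l)}dx$: every functional $\mathfrak G$ on $J^\infty$ has variational derivatives, and $\mathrm{pr}(\mathrm X_{(l)})\mathfrak G=\{\mathfrak G,\mathfrak H^{(l)}\}$. 4. $H^{(l)}=\frac1{2+4l}D_x^{-1}\big(-A(\mathrm u,\mathrm h_{(l)})+A(\mathbf u,\mathbf h_{(l)})\big)=\frac1{1+2l}\mathrm h_\parallel^{(l)}$, where $\mathrm h_\parallel^{(l)}$ is $\mathrm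 h_\parallel$ for $(\mathrm h,\mathbf h)=(\mathrm h_{(l)},\mathbf h_{(l)})$. 5. The variational derivatives of the Hamiltonians are $-\delta H^{(l)}/\delta\mathrm u=\mathrm w_{(l)}$, $\delta H^{(l)}/\delta\overline{\mathbf u}=\mathbf w_{(l)}$. 6. The covector fields $\mathrm w_{(l)}\cdot d\mathrm u+\mathrm{Re}(\mathbf w_{(l)}\cdot d\mathbf u)$ are involutive: $\{\mathfrak H^{(k)},\mathfrak H^{(l)}\}=\mathrm{Re}\int\big\langle(\mathrm w_{(k)},\mathbf w_{(k)}),\mathcal H(\mathrm w_{(l)},\mathbf w_{(l)})\big\rangle dx=0$. 7. They are dual to the Hamiltonian vector fields: for every evolutionary vector field $\mathrm X$ on $J^\infty$, $$\int\big(\mathrm w_{(l+1)}\cdot d\mathrm u+\mathrm{Re}(\mathbf w_{(l+1)}\cdot d\mathbf u)\big)\rfloor\mathrm X\,dx=\boldsymbol\omega(\mathrm X,\mathrm X_{(l)}).$$ -/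

import Mathlib

open scoped ContDiff Quaternion

namespace QuatHierarchy

noncomputable section

/-! ### Quaternionic algebra -/

/-- The space `𝒬` of imaginary quaternions. -/
def ImQ : Submodule ℝ ℍ[ℝ] where
  carrier := {q | q.re = 0}
  add_mem' := by
    intro a b ha hb
    simp only [Set.mem_ofPred_eq] at *
    simp [ha, hb]
  zero_mem' := by simp
  smul_mem' := by
    intro c a ha
    simp only [Set.mem_ofPred_eq] at *
    simp [ha]

/-- Quaternion row vectors with `m` components. -/
abbrev QVec (m : ℕ) : Type := Fin m → ℍ[ℝ]

/-- The space `𝒬 ⊕ ℍ ^ m` in which the pair (scalar, vector) takes its values. -/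
abbrev Val (m : ℕ) : Type := ImQ × QVec m

/-- The Hermitian inner product `⟨x, y⟩ = ∑ i, x i * conj (y i)`. -/
def herm {m : ℕ} (x y : QVec m) : ℍ[ℝ] := ∑ i, x i * star (y i)

/-- The commutator `C(a, b) = a b - b a` of imaginary quaternions. -/
def commQ (a b : ImQ) : ImQ :=
  ⟨(a : ℍ[ℝ]) * b - b * a, by
    change ((a : ℍ[ℝ]) * b - b * a).re = 0
    simp only [Quaternion.re_sub, Quaternion.re_mul]
    ring⟩

theorem star_herm {m : ℕ} (x y : QVec m) : star (herm x y) = herm y x := by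
  simp [herm]

/-- The commutator `C(a, b) = ⟨a, b⟩ - ⟨b, a⟩` of quaternion vectors. -/
def commV {m : ℕ} (a b : QVec m) : ImQ :=
  ⟨herm a b - herm b a, by
    change (herm a b - herm b a).re = 0
    rw [← star_herm a b]
    simp⟩

/-- The matrix commutator of quaternion vectors, `conj(a)ᵗ b - conj(b)ᵗ a`,
a skew-Hermitian quaternion matrix. -/
def commM {m : ℕ} (a b : QVec m) : Fin m → Fin m → ℍ[ℝ] :=
  fun i j => star (a i) * b j - star (b i) * a j

/-- The anticommutator `A(a, b) = a b + b a` of imaginary quaternions (a real number). -/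
def antiQ (a b : ImQ) : ℝ := ((a : ℍ[ℝ]) * b + b * a).re

theorem coe_antiQ (a b : ImQ) : ((antiQ a b : ℝ) : ℍ[ℝ]) = (a : ℍ[ℝ]) * b + b * a := by
  have ha : (a : ℍ[ℝ]).re = 0 := a.2
  have hb : (b : ℍ[ℝ]).re = 0 := b.2
  ext <;> simp [antiQ, ha, hb] <;> ring

/-- The anticommutator `A(a, b) = ⟨a, b⟩ + ⟨b, a⟩` of quaternion vectors (a real number). -/
def antiV {m : ℕ} (a b : QVec m) : ℝ := (herm a b + herm b a).re

theorem coe_antiV {m : ℕ} (a b : QVec m) :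
    ((antiV a b : ℝ) : ℍ[ℝ]) = herm a b + herm b a := by
  rw [antiV, ← star_herm a b]
  ext <;> simp

/-- Left multiplication of a quaternion vector by an imaginary quaternion. -/
def leftMul {m : ℕ} (a : ImQ) (v : QVec m) : QVec m := fun j => (a : ℍ[ℝ]) * v j

/-- The row vector `v` times the matrix `M`. -/
def vecMat {m : ℕ} (v : QVec m) (M : Fin m → Fin m → ℍ[ℝ]) : QVec m :=
  fun j => ∑ i, v i * M i j

/-- `Re (⟨a, b⟩ + ⟨𝐚, 𝐛⟩)` for pairs `(a, 𝐚)`, `(b, 𝐛)` in `𝒬 ⊕ ℍ ^ m`. -/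
def rePair {m : ℕ} (a b : Val m) : ℝ :=
  ((a.1 : ℍ[ℝ]) * star (b.1 : ℍ[ℝ]) + herm a.2 b.2).re

/-! ### Calculus on the jet space -/

/-- The infinite jet space: a point `p` consists of the value `p.1` of `x` and the values `p.2 k`
of the `k`-th `x`-derivative of the pair `(u, 𝐮)`, for all `k`. -/
abbrev Jet (m : ℕ) : Type := ℝ × (ℕ → Val m)

/-- A function on the jet space: it is smooth and depends only on `x` and on finitely many of
the derivatives of `(u, 𝐮)`. -/
def IsLocal {m : ℕ} {W : Type} [NormedAddCommGroup W] [NormedSpace ℝ W] (f : Jet m → W) : Prop :=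
  ∃ (k : ℕ) (F : ℝ × (Fin k → Val m) → W),
    ContDiff ℝ ∞ F ∧ ∀ p, f p = F (p.1, fun i => p.2 i)

/-- The total `x`-derivative `∂/∂x + u_x ∂/∂u + u_xx ∂/∂u_x + ⋯`. -/
def Dx {m : ℕ} {W : Type} [NormedAddCommGroup W] [NormedSpace ℝ W] (f : Jet m → W) : Jet m → W :=
  fun p => lineDeriv ℝ f p (1, fun k => p.2 (k + 1))

/-- `f` is the total derivative of a function on the jet space. -/
def IsTotalDeriv {m : ℕ} {W : Type} [NormedAddCommGroup W] [NormedSpace ℝ W]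
    (f : Jet m → W) : Prop :=
  ∃ g : Jet m → W, IsLocal g ∧ Dx g = f

open Classical in
/-- The formal inverse of `Dx`: on a total derivative `f` it is the function `g` on the jet space
with `Dx g = f` that vanishes at `x = 0, (u, 𝐮) = 0, (u, 𝐮)_x = 0, …`, so that no constant
of integration appears. (The value on other functions is a convention.) -/
def DxInv {m : ℕ} {W : Type} [NormedAddCommGroup W] [NormedSpace ℝ W]
    (f : Jet m → W) : Jet m → W :=
  if h : ∃ g : Jet m → W, IsLocal g ∧ Dx g = f ∧ g 0 = 0 then h.choose else 0

/-- Equality of the functionals `∫ f dx` and `∫ g dx`, that is, equality of densities modulo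
total `x`-derivatives. -/
def EqFunctional {m : ℕ} (f g : Jet m → ℝ) : Prop :=
  IsTotalDeriv (fun p => f p - g p)

/-- The prolongation to the jet space of the evolutionary vector field
`h · ∂/∂u + Re (𝐡 · ∂/∂𝐮)` with characteristic `X = (h, 𝐡)`, acting on functions:
the component along `∂/∂u_(k)` is the `k`-th total derivative of `X`. -/
def prolong {m : ℕ} {W : Type} [NormedAddCommGroup W] [NormedSpace ℝ W]
    (X : Jet m → Val m) (f : Jet m → W) : Jet m → W :=
  fun p => lineDeriv ℝ f p (0, fun k => Dx^[k] X p)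

/-- The density `Re (⟨f, g⟩ + ⟨𝐟, 𝐠⟩)`. -/
def pairing {m : ℕ} (f g : Jet m → Val m) : Jet m → ℝ := fun p => rePair (f p) (g p)

/-- `w = (-δ𝔊/δu, δ𝔊/δ(conj 𝐮))` is the pair of variational derivatives of `𝔊 = ∫ G dx`:
`∫ pr(X) G dx = ∫ Re ⟨X, w⟩ dx` for every evolutionary vector field `X`. -/
def IsVarDeriv {m : ℕ} (G : Jet m → ℝ) (w : Jet m → Val m) : Prop :=
  IsLocal w ∧
    ∀ X : Jet m → Val m, IsLocal X → EqFunctional (prolong X G) (pairing X w)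

open Classical in
/-- The pair of variational derivatives `(-δ𝔊/δu, δ𝔊/δ(conj 𝐮))` of `𝔊 = ∫ G dx`. -/
def varDeriv {m : ℕ} (G : Jet m → ℝ) : Jet m → Val m :=
  if h : ∃ w, IsVarDeriv G w then h.choose else 0

/-! ### The operators -/

/-- The coordinate function `(u, 𝐮)` on the jet space. -/
def uFun (m : ℕ) : Jet m → Val m := fun p => p.2 0

/-- The coordinate function `(u_x, 𝐮_x)` on the jet space. -/
def uxFun (m : ℕ) : Jet m → Val m := fun p => p.2 1

/-- The density `C(u, w) - ½ C(𝐮, 𝐰)`. -/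
def scalarCurr {m : ℕ} (w : Jet m → Val m) : Jet m → ImQ :=
  fun p => commQ (p.2 0).1 (w p).1 - (1 / 2 : ℝ) • commV (p.2 0).2 (w p).2

/-- The density `𝐂(𝐮, 𝐰)`. -/
def matrixCurr {m : ℕ} (w : Jet m → Val m) : Jet m → Fin m → Fin m → ℍ[ℝ] :=
  fun p => commM (p.2 0).2 (w p).2

/-- `w∥ = - Dx⁻¹ (C(u, w) - ½ C(𝐮, 𝐰))`. -/
def wPar {m : ℕ} (w : Jet m → Val m) : Jet m → ImQ := fun p => -DxInv (scalarCurr w) p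

/-- `𝐖∥ = Dx⁻¹ 𝐂(𝐮, 𝐰)`. -/
def WPar {m : ℕ} (w : Jet m → Val m) : Jet m → Fin m → Fin m → ℍ[ℝ] := DxInv (matrixCurr w)

/-- The operator `ℋ`:
`(w, 𝐰) ↦ (Dx w + C(u, w∥) + ½ C(𝐮, 𝐰), Dx 𝐰 - w∥ 𝐮 + 𝐮 𝐖∥ + w 𝐮 - u 𝐰)`. -/
def opH {m : ℕ} (w : Jet m → Val m) : Jet m → Val m := fun p =>
  (Dx (fun q => (w q).1) p + commQ (p.2 0).1 (wPar w p)
      + (1 / 2 : ℝ) • commV (p.2 0).2 (w p).2,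
   Dx (fun q => (w q).2) p - leftMul (wPar w p) (p.2 0).2 + vecMat (p.2 0).2 (WPar w p)
      + leftMul (w p).1 (p.2 0).2 - leftMul (p.2 0).1 (w p).2)

/-- The natural domain of `ℋ`: the inverse total derivatives in it exist on the jet space. -/
def DomH {m : ℕ} (w : Jet m → Val m) : Prop :=
  IsLocal w ∧ IsTotalDeriv (scalarCurr w) ∧ IsTotalDeriv (matrixCurr w)

/-- The density `½ (-A(u, h) + A(𝐮, 𝐡))`. -/
def realCurr {m : ℕ} (h : Jet m → Val m) : Jet m → ℝ :=
  fun p => (1 / 2) * (-antiQ (p.2 0).1 (h p).1 + antiV (p.2 0).2 (h p).2)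

/-- `h∥ = Dx⁻¹ (-½ A(u, h) + ½ A(𝐮, 𝐡))`. -/
def hPar {m : ℕ} (h : Jet m → Val m) : Jet m → ℝ := DxInv (realCurr h)

/-- The operator `𝒥`:
`(h, 𝐡) ↦ (¼ Dx h + ¼ C(𝐮, 𝐡) + h∥ u, Dx 𝐡 + ½ h 𝐮 + u 𝐡 + h∥ 𝐮)`. -/
def opJ {m : ℕ} (h : Jet m → Val m) : Jet m → Val m := fun p =>
  ((1 / 4 : ℝ) • Dx (fun q => (h q).1) p + (1 / 4 : ℝ) • commV (p.2 0).2 (h p).2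
      + hPar h p • (p.2 0).1,
   Dx (fun q => (h q).2) p + (1 / 2 : ℝ) • leftMul (h p).1 (p.2 0).2
      + leftMul (p.2 0).1 (h p).2 + hPar h p • (p.2 0).2)

/-- The natural domain of `𝒥`: the inverse total derivative in it exists on the jet space. -/
def DomJ {m : ℕ} (h : Jet m → Val m) : Prop := IsLocal h ∧ IsTotalDeriv (realCurr h)

/-- The recursion operator `ℛ = ℋ 𝒥`. -/
def opR {m : ℕ} (h : Jet m → Val m) : Jet m → Val m := opH (opJ h)

/-- The natural domain of `ℛ`. -/
def DomR {m : ℕ} (h : Jet m → Val m) : Prop := DomJ h ∧ DomH (opJ h)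

/-- The adjoint recursion operator `ℛ* = 𝒥* ℋ* = 𝒥 ℋ`. -/
def opRstar {m : ℕ} (w : Jet m → Val m) : Jet m → Val m := opJ (opH w)

/-- The natural domain of `ℛ*`. -/
def DomRstar {m : ℕ} (w : Jet m → Val m) : Prop := DomH w ∧ DomJ (opH w)

/-- The density of the Poisson bracket `{𝔊₁, 𝔊₂} = Re ∫ ⟨δ𝔊₁, ℋ δ𝔊₂⟩ dx`. -/
def poisson {m : ℕ} (G₁ G₂ : Jet m → ℝ) : Jet m → ℝ :=
  pairing (varDeriv G₁) (opH (varDeriv G₂))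

/-- The density of the symplectic form `ω(X₁, X₂) = Re ∫ ⟨X₁, 𝒥 X₂⟩ dx`. -/
def symp {m : ℕ} (X₁ X₂ : Jet m → Val m) : Jet m → ℝ := pairing X₁ (opJ X₂)

/-- The contraction `(w · du + Re (𝐰 · d𝐮)) ⌟ X` of a covector field with an evolutionary vector
field. -/
def contract {m : ℕ} (w X : Jet m → Val m) : Jet m → ℝ := pairing X w

/-! ### The hierarchies -/

/-- `(h_(l), 𝐡_(l)) = ℛ ^ l (u_x, 𝐮_x)`. -/
def hSeq (m l : ℕ) : Jet m → Val m := opR^[l] (uxFun m)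

/-- `(w_(l), 𝐰_(l)) = ℛ* ^ l (u, 𝐮)`. -/
def wSeq (m l : ℕ) : Jet m → Val m := opRstar^[l] (uFun m)

/-- `H^(l) = 1 / (1 + 2 l) * Dx⁻¹ Re (⟨u, h_(l)⟩ + ⟨𝐮, 𝐡_(l)⟩)`. -/
def Ham (m l : ℕ) : Jet m → ℝ :=
  fun p => 1 / (1 + 2 * (l : ℝ)) * DxInv (pairing (uFun m) (hSeq m l)) p

end

end QuatHierarchy

/-!
The hierarchy is generated by a formal power series `V = e + V₁ z + V₂ z² + ⋯` with coefficients in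
the matrices over the ring of quaternion-valued functions on the jet space, where `e` is the Cartan
element of a symmetric Lie algebra `𝔨 ⊕ 𝔪`. It solves the Lax equation `z Dx V = ⁅e + z U, V⁆`, in
which the potential `U ∈ 𝔨` is built from `(u, 𝐮)`. As `e ^ 3 = e`, one can impose `V ^ 3 = V`, and
then every coefficient is determined algebraically by the preceding ones. No integration takes
place, so all coefficients are functions on the jet space.

By uniqueness, `V` inherits the Cartan involution and the conjugate transpose, which places the odd
coefficients in `𝔨` and the even ones in `𝔪`. Their components that do not commute with `e` are
`(w_(l), 𝐰_(l))` and, up to the bracket with `e`, `(h_(l), 𝐡_(l))`; those that commute with `e` are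
the nonlocal terms `w^∥`, `𝐖^∥` and `h_∥`. The Lax equation then says that `ℋ` and `𝒥` map each of
these pairs to the next one, and that every `Dx⁻¹` is applied to a total derivative.

The flow of `(h_(l), 𝐡_(l))` moves `V` by the bracket with a truncation of `V`, so the flows
commute. As `V ^ 3 = V`, both `z ∂/∂z` and every evolutionary vector field act on `V` as commutators
with `V`; the resulting trace identity computes the variational derivatives of the Hamiltonians.
Involutivity follows from the skewness of `ℋ` and `𝒥`.
-/

namespace QuatHierarchy

noncomputable section

open PowerSeries

attribute [local instance] LieRing.ofAssociativeRing

/-! ### Derivatives of local functions along vector fields -/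

section Calculus

variable {m : ℕ} {W W' W'' : Type} [NormedAddCommGroup W] [NormedSpace ℝ W]
  [NormedAddCommGroup W'] [NormedSpace ℝ W'] [NormedAddCommGroup W''] [NormedSpace ℝ W'']

/-- Truncation of a jet to `x` and the derivatives of order less than `k`. -/
def jetProj (m k : ℕ) : Jet m →ₗ[ℝ] ℝ × (Fin k → Val m) where
  toFun p := (p.1, fun i => p.2 i)
  map_add' _ _ := rfl
  map_smul' _ _ := rfl

/-- `f` is a smooth function of `x` and the derivatives of order less than `k`. -/
def IsLocalOfOrder (k : ℕ) (f : Jet m → W) : Prop :=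
  ∃ F : ℝ × (Fin k → Val m) → W, ContDiff ℝ ∞ F ∧ f = fun p => F (jetProj m k p)

theorem isLocal_iff_exists_isLocalOfOrder {f : Jet m → W} :
    IsLocal f ↔ ∃ k, IsLocalOfOrder k f :=
  exists_congr fun _ => exists_congr fun _ => and_congr_right fun _ => funext_iff.symm

theorem IsLocalOfOrder.isLocal {k : ℕ} {f : Jet m → W} (h : IsLocalOfOrder k f) : IsLocal f :=
  isLocal_iff_exists_isLocalOfOrder.2 ⟨k, h⟩

theorem IsLocalOfOrder.mono {k l : ℕ} (hkl : k ≤ l) {f : Jet m → W} (h : IsLocalOfOrder k f) :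
    IsLocalOfOrder l f := by
  obtain ⟨F, hF, rfl⟩ := h
  exact ⟨fun q => F (q.1, fun i => q.2 (Fin.castLE hkl i)), hF.comp (by fun_prop), rfl⟩

theorem IsLocalOfOrder.prodMk {k : ℕ} {f : Jet m → W} {g : Jet m → W'}
    (hf : IsLocalOfOrder k f) (hg : IsLocalOfOrder k g) :
    IsLocalOfOrder k (fun p => (f p, g p)) := by
  obtain ⟨F, hF, rfl⟩ := hf
  obtain ⟨G, hG, rfl⟩ := hg
  exact ⟨fun q => (F q, G q), hF.prodMk hG, rfl⟩

theorem IsLocalOfOrder.comp {k : ℕ} {f : Jet m → W} (hf : IsLocalOfOrder k f) {G : W → W'}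
    (hG : ContDiff ℝ ∞ G) : IsLocalOfOrder k (fun p => G (f p)) := by
  obtain ⟨F, hF, rfl⟩ := hf
  exact ⟨fun q => G (F q), hG.comp hF, rfl⟩

theorem IsLocal.exists_common_order {f : Jet m → W} {g : Jet m → W'} (hf : IsLocal f)
    (hg : IsLocal g) : ∃ k, IsLocalOfOrder k f ∧ IsLocalOfOrder k g := by
  obtain ⟨k, hf⟩ := isLocal_iff_exists_isLocalOfOrder.1 hf
  obtain ⟨l, hg⟩ := isLocal_iff_exists_isLocalOfOrder.1 hg
  exact ⟨max k l, hf.mono (le_max_left _ _), hg.mono (le_max_right _ _)⟩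

theorem IsLocal.prodMk {f : Jet m → W} {g : Jet m → W'} (hf : IsLocal f) (hg : IsLocal g) :
    IsLocal (fun p => (f p, g p)) := by
  obtain ⟨k, hf, hg⟩ := hf.exists_common_order hg
  exact (hf.prodMk hg).isLocal

theorem IsLocal.comp {f : Jet m → W} (hf : IsLocal f) {G : W → W'}
    (hG : ContDiff ℝ ∞ G) : IsLocal (fun p => G (f p)) := by
  obtain ⟨k, hf⟩ := isLocal_iff_exists_isLocalOfOrder.1 hf
  exact (hf.comp hG).isLocal

theorem isLocal_pi {ι : Type} [Fintype ι] {E : ι → Type} [∀ i, NormedAddCommGroup (E i)]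
    [∀ i, NormedSpace ℝ (E i)] {f : ∀ i, Jet m → E i} (hf : ∀ i, IsLocal (f i)) :
    IsLocal (fun p i => f i p) := by
  choose k hk using fun i => isLocal_iff_exists_isLocalOfOrder.1 (hf i)
  choose F hF hf using fun i => (hk i).mono (Finset.le_sup (f := k) (Finset.mem_univ i))
  exact ⟨Finset.univ.sup k, fun q i => F i q, contDiff_pi.2 hF,
    fun p => funext fun i => congrFun (hf i) p⟩

theorem isLocal_const (c : W) : IsLocal (fun _ : Jet m => c) :=
  ⟨0, fun _ => c, contDiff_const, fun _ => rfl⟩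

theorem isLocalOfOrder_coord (k : ℕ) : IsLocalOfOrder (k + 1) (fun p : Jet m => p.2 k) :=
  ⟨fun q => q.2 (Fin.last k), by fun_prop, rfl⟩

theorem isLocal_coord (k : ℕ) : IsLocal (fun p : Jet m => p.2 k) :=
  (isLocalOfOrder_coord k).isLocal

theorem isLocal_jetProj (k : ℕ) : IsLocal (fun p : Jet m => jetProj m k p) :=
  ⟨k, id, contDiff_id, fun _ => rfl⟩

theorem IsLocal.clm (L : W →L[ℝ] W') {f : Jet m → W} (hf : IsLocal f) :
    IsLocal (fun p => L (f p)) :=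
  hf.comp L.contDiff

theorem IsLocal.bilin (B : W →L[ℝ] W' →L[ℝ] W'') {f : Jet m → W} {g : Jet m → W'}
    (hf : IsLocal f) (hg : IsLocal g) : IsLocal (fun p => B (f p) (g p)) :=
  (hf.prodMk hg).comp (G := fun x : W × W' => B x.1 x.2) B.isBoundedBilinearMap.contDiff

theorem IsLocal.add {f g : Jet m → W} (hf : IsLocal f) (hg : IsLocal g) :
    IsLocal (fun p => f p + g p) :=
  (hf.prodMk hg).comp (G := fun x : W × W => x.1 + x.2) (by fun_prop)

theorem IsLocal.neg {f : Jet m → W} (hf : IsLocal f) : IsLocal (fun p => -f p) :=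
  hf.comp contDiff_neg

theorem IsLocal.sub {f g : Jet m → W} (hf : IsLocal f) (hg : IsLocal g) :
    IsLocal (fun p => f p - g p) :=
  (hf.prodMk hg).comp (G := fun x : W × W => x.1 - x.2) (by fun_prop)

theorem IsLocal.const_smul (c : ℝ) {f : Jet m → W} (hf : IsLocal f) :
    IsLocal (fun p => c • f p) :=
  hf.comp (contDiff_const_smul c)

theorem IsLocal.smul {c : Jet m → ℝ} {f : Jet m → W} (hc : IsLocal c) (hf : IsLocal f) :
    IsLocal (fun p => c p • f p) :=
  IsLocal.bilin (ContinuousLinearMap.lsmul ℝ ℝ) hc hf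

theorem lineDeriv_comp_jetProj {k : ℕ} {F : ℝ × (Fin k → Val m) → W} (hF : ContDiff ℝ ∞ F)
    (p v : Jet m) : lineDeriv ℝ (fun p => F (jetProj m k p)) p v =
      fderiv ℝ F (jetProj m k p) (jetProj m k v) := by
  rw [← (hF.differentiable (by simp) _).lineDeriv_eq_fderiv]
  simp [lineDeriv]

theorem IsLocal.lineDifferentiableAt {f : Jet m → W} (hf : IsLocal f) (p v : Jet m) :
    LineDifferentiableAt ℝ f p v := by
  obtain ⟨k, F, hF, rfl⟩ := isLocal_iff_exists_isLocalOfOrder.1 hf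
  have h := (hF.differentiable (by simp) (jetProj m k p)).lineDifferentiableAt
    (v := jetProj m k v)
  simpa [LineDifferentiableAt] using h

theorem IsLocal.lineDeriv_comp {f : Jet m → W} (hf : IsLocal f) {G : W → W'}
    (hG : ContDiff ℝ ∞ G) (p v : Jet m) :
    lineDeriv ℝ (fun q => G (f q)) p v = fderiv ℝ G (f p) (lineDeriv ℝ f p v) := by
  obtain ⟨k, F, hF, rfl⟩ := isLocal_iff_exists_isLocalOfOrder.1 hf
  have h := lineDeriv_comp_jetProj (hG.comp hF) p v
  rw [fderiv_comp _ (hG.differentiable (by simp) _) (hF.differentiable (by simp) _)] at h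
  rw [lineDeriv_comp_jetProj hF]
  exact h

theorem IsLocal.lineDeriv_prodMk {f : Jet m → W} {g : Jet m → W'} (hf : IsLocal f)
    (hg : IsLocal g) (p v : Jet m) :
    lineDeriv ℝ (fun q => (f q, g q)) p v = (lineDeriv ℝ f p v, lineDeriv ℝ g p v) :=
  HasDerivAt.deriv ((hf.lineDifferentiableAt p v).hasDerivAt.prodMk
    (hg.lineDifferentiableAt p v).hasDerivAt)

theorem lineDeriv_pi {ι : Type} [Fintype ι] {E : ι → Type} [∀ i, NormedAddCommGroup (E i)]
    [∀ i, NormedSpace ℝ (E i)] {f : ∀ i, Jet m → E i} (hf : ∀ i, IsLocal (f i)) (p v : Jet m) :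
    lineDeriv ℝ (fun q i => f i q) p v = fun i => lineDeriv ℝ (f i) p v :=
  HasDerivAt.deriv (hasDerivAt_pi.2 fun i => ((hf i).lineDifferentiableAt p v).hasDerivAt)

theorem IsLocal.lineDeriv_clm (L : W →L[ℝ] W') {f : Jet m → W} (hf : IsLocal f) (p v : Jet m) :
    lineDeriv ℝ (fun q => L (f q)) p v = L (lineDeriv ℝ f p v) := by
  rw [hf.lineDeriv_comp L.contDiff, L.fderiv]

theorem IsLocal.lineDeriv_bilin (B : W →L[ℝ] W' →L[ℝ] W'') {f : Jet m → W} {g : Jet m → W'}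
    (hf : IsLocal f) (hg : IsLocal g) (p v : Jet m) :
    lineDeriv ℝ (fun q => B (f q) (g q)) p v =
      B (lineDeriv ℝ f p v) (g p) + B (f p) (lineDeriv ℝ g p v) := by
  have h := (hf.prodMk hg).lineDeriv_comp (G := fun x : W × W' => B x.1 x.2)
    B.isBoundedBilinearMap.contDiff p v
  rw [hf.lineDeriv_prodMk hg, B.isBoundedBilinearMap.fderiv] at h
  simpa [add_comm] using h

theorem IsLocal.lineDeriv_add {f g : Jet m → W} (hf : IsLocal f) (hg : IsLocal g)
    (p v : Jet m) :
    lineDeriv ℝ (fun q => f q + g q) p v = lineDeriv ℝ f p v + lineDeriv ℝ g p v :=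
  HasDerivAt.deriv ((hf.lineDifferentiableAt p v).hasDerivAt.add
    (hg.lineDifferentiableAt p v).hasDerivAt)

theorem lineDeriv_coord (k : ℕ) (p v : Jet m) :
    lineDeriv ℝ (fun p : Jet m => p.2 k) p v = v.2 k := by
  have h : HasDerivAt (fun t : ℝ => p.2 k + t • v.2 k) ((1 : ℝ) • v.2 k) 0 :=
    ((hasDerivAt_id (0 : ℝ)).smul_const (v.2 k)).const_add (p.2 k)
  simpa [lineDeriv] using h.deriv

/-- The derivative of `f` along the vector field `v` on the jet space. -/
def derivAlong (v : Jet m → Jet m) (f : Jet m → W) : Jet m → W := fun p => lineDeriv ℝ f p (v p)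

/-- The vector field `∂/∂x + u_x ∂/∂u + u_xx ∂/∂u_x + ⋯`, along which `Dx` differentiates. -/
def totalField (m : ℕ) : Jet m → Jet m := fun p => (1, fun k => p.2 (k + 1))

/-- The prolonged evolutionary vector field, along which `prolong X` differentiates. -/
def prolongField (X : Jet m → Val m) : Jet m → Jet m := fun p => (0, fun k => Dx^[k] X p)

/-- A vector field on the jet space all of whose components are local functions. -/
def IsLocalField (v : Jet m → Jet m) : Prop :=
  IsLocal (fun p => (v p).1) ∧ ∀ k, IsLocal (fun p => (v p).2 k)

theorem isLocalField_totalField : IsLocalField (totalField m) :=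
  ⟨isLocal_const 1, fun k => isLocal_coord (k + 1)⟩

theorem IsLocalField.isLocal_jetProj_comp {v : Jet m → Jet m} (hv : IsLocalField v) (k : ℕ) :
    IsLocal (fun p => jetProj m k (v p)) :=
  hv.1.prodMk (isLocal_pi fun i : Fin k => hv.2 i)

theorem derivAlong_comp_jetProj {k : ℕ} {F : ℝ × (Fin k → Val m) → W} (hF : ContDiff ℝ ∞ F)
    (v : Jet m → Jet m) : derivAlong v (fun p => F (jetProj m k p)) =
      fun p => fderiv ℝ F (jetProj m k p) (jetProj m k (v p)) :=
  funext fun p => lineDeriv_comp_jetProj hF p (v p)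

theorem IsLocalField.isLocal_derivAlong {v : Jet m → Jet m} (hv : IsLocalField v)
    {f : Jet m → W} (hf : IsLocal f) : IsLocal (derivAlong v f) := by
  obtain ⟨k, F, hF, rfl⟩ := isLocal_iff_exists_isLocalOfOrder.1 hf
  rw [derivAlong_comp_jetProj hF]
  have hdF : IsLocal (fun p : Jet m => fderiv ℝ F (jetProj m k p)) :=
    (isLocal_jetProj k).comp (hF.fderiv_right (m := ∞) (by simp))
  exact hdF.bilin (ContinuousLinearMap.id ℝ _) (hv.isLocal_jetProj_comp k)

protected theorem IsLocal.Dx {f : Jet m → W} (hf : IsLocal f) : IsLocal (Dx f) :=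
  isLocalField_totalField.isLocal_derivAlong hf

theorem IsLocal.iterate_Dx {f : Jet m → W} (hf : IsLocal f) (k : ℕ) : IsLocal (Dx^[k] f) := by
  induction k with
  | zero => exact hf
  | succ k ih => rw [Function.iterate_succ_apply']; exact ih.Dx

theorem isLocalField_prolongField {X : Jet m → Val m} (hX : IsLocal X) :
    IsLocalField (prolongField X) :=
  ⟨isLocal_const 0, fun k => hX.iterate_Dx k⟩

theorem IsLocalField.derivAlong_jetProj {w : Jet m → Jet m} (hw : IsLocalField w)
    (v : Jet m → Jet m) (k : ℕ) :
    derivAlong v (fun p => jetProj m k (w p)) = fun p =>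
      (derivAlong v (fun p => (w p).1) p,
        fun i : Fin k => derivAlong v (fun p => (w p).2 i) p) := by
  funext p
  refine (hw.1.lineDeriv_prodMk (isLocal_pi fun i : Fin k => hw.2 i) p (v p)).trans ?_
  rw [lineDeriv_pi fun i : Fin k => hw.2 i]
  rfl

theorem IsLocalField.derivAlong_derivAlong_comp_jetProj {w : Jet m → Jet m}
    (hw : IsLocalField w) (v : Jet m → Jet m) {k : ℕ} {F : ℝ × (Fin k → Val m) → W}
    (hF : ContDiff ℝ ∞ F) (p : Jet m) :
    derivAlong v (derivAlong w fun p => F (jetProj m k p)) p =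
      fderiv ℝ (fderiv ℝ F) (jetProj m k p) (jetProj m k (v p)) (jetProj m k (w p)) +
        fderiv ℝ F (jetProj m k p) (derivAlong v (fun p => jetProj m k (w p)) p) := by
  have hdF : ContDiff ℝ ∞ (fderiv ℝ F) := hF.fderiv_right (m := ∞) (by simp)
  rw [derivAlong_comp_jetProj hF]
  refine (((isLocal_jetProj k).comp hdF).lineDeriv_bilin (ContinuousLinearMap.id ℝ _)
    (hw.isLocal_jetProj_comp k) p (v p)).trans ?_
  rw [lineDeriv_comp_jetProj hdF]
  rfl

theorem IsLocalField.derivAlong_comm {v w : Jet m → Jet m} (hv : IsLocalField v)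
    (hw : IsLocalField w)
    (hx : derivAlong v (fun p => (w p).1) = derivAlong w (fun p => (v p).1))
    (hu : ∀ k, derivAlong v (fun p => (w p).2 k) = derivAlong w (fun p => (v p).2 k))
    {f : Jet m → W} (hf : IsLocal f) :
    derivAlong v (derivAlong w f) = derivAlong w (derivAlong v f) := by
  obtain ⟨k, F, hF, rfl⟩ := isLocal_iff_exists_isLocalOfOrder.1 hf
  funext p
  have hsymm : IsSymmSndFDerivAt ℝ F (jetProj m k p) :=
    hF.contDiffAt.isSymmSndFDerivAt (by
      simp only [minSmoothness_of_isRCLikeNormedField]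
      exact WithTop.coe_le_coe.2 (le_top : (2 : ℕ∞) ≤ ⊤))
  rw [hw.derivAlong_derivAlong_comp_jetProj v hF, hv.derivAlong_derivAlong_comp_jetProj w hF,
    hsymm.eq, hw.derivAlong_jetProj, hv.derivAlong_jetProj, hx]
  simp only [hu]

theorem Dx_prolong {X : Jet m → Val m} (hX : IsLocal X) {f : Jet m → W} (hf : IsLocal f) :
    Dx (prolong X f) = prolong X (Dx f) := by
  refine isLocalField_totalField.derivAlong_comm (isLocalField_prolongField hX) ?_
    (fun k => ?_) hf
  · funext p
    simp [derivAlong, prolongField, totalField, lineDeriv]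
  · funext p
    refine Eq.trans ?_ (lineDeriv_coord (k + 1) p _).symm
    simp only [prolongField, Function.iterate_succ_apply']
    rfl

end Calculus

/-! ### Elements with cube equal to themselves -/

section Cubic

variable {A : Type*} [Ring A]

/-- The linearization `w ↦ v²w + vwv + wv² - w` of `v ↦ v³ - v`. -/
def cubicLin (v w : A) : A := v * v * w + v * w * v + w * v * v - w

theorem cubicLin_add (v w w' : A) : cubicLin v (w + w') = cubicLin v w + cubicLin v w' := by
  simp only [cubicLin]
  noncomm_ring

theorem map_cubicLin {B : Type*} [Ring B] (φ : A →+* B) (v w : A) :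
    φ (cubicLin v w) = cubicLin (φ v) (φ w) := by
  simp only [cubicLin, map_add, map_sub, map_mul]

theorem mul_mul_self_of_cube {v : A} (hv : v ^ 3 = v) : v * (v * v) = v := by
  rw [← pow_two, ← pow_succ', hv]

theorem mul_mul_mul_of_cube {v : A} (hv : v ^ 3 = v) (x : A) : v * (v * (v * x)) = v * x := by
  rw [← mul_assoc v v x, ← mul_assoc v, mul_mul_self_of_cube hv]

theorem lie_cubicLin {v : A} (hv : v ^ 3 = v) (w : A) : ⁅v, cubicLin v w⁆ = 0 := by
  simp only [Ring.lie_def, cubicLin, mul_add, add_mul, mul_sub, sub_mul, mul_assoc,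
    mul_mul_self_of_cube hv, mul_mul_mul_of_cube hv]
  abel

theorem cubicLin_lie {v : A} (hv : v ^ 3 = v) (w : A) : cubicLin v ⁅v, w⁆ = 0 := by
  simp only [Ring.lie_def, cubicLin, mul_sub, sub_mul, mul_assoc, mul_mul_self_of_cube hv,
    mul_mul_mul_of_cube hv]
  abel

variable [Algebra ℝ A]

/-- The inverse of the commutator with `v`, where `v³ = v`, on the kernel of `cubicLin v`. Left and
right multiplication by `v` have eigenvalues `a, b ∈ {-1, 0, 1}`. On the joint eigenspace, the
commutator with `v` acts by `a - b` and `cubicLin v` by `a² + ab + b² - 1`, which vanishes exactly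
when `a ≠ b`; there, `(a - b) + ¾ab(a - b)` is the inverse of `a - b`. -/
def adInv (v w : A) : A := ⁅v, w⁆ + (3 / 4 : ℝ) • (v * ⁅v, w⁆ * v)

theorem lie_adInv {v w : A} (hv : v ^ 3 = v) (hw : cubicLin v w = 0) : ⁅v, adInv v w⁆ = w := by
  have expand : ⁅v, adInv v w⁆ = w + cubicLin v w - (3 / 2 : ℝ) • (v * cubicLin v w * v) := by
    simp only [adInv, Ring.lie_def, cubicLin, mul_add, add_mul, mul_sub, sub_mul, mul_smul_comm,
      smul_mul_assoc, mul_assoc, mul_mul_self_of_cube hv, mul_mul_mul_of_cube hv]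
    module
  rw [expand, hw, mul_zero, zero_mul, smul_zero, add_zero, sub_zero]

theorem cubicLin_adInv {v : A} (hv : v ^ 3 = v) (w : A) : cubicLin v (adInv v w) = 0 := by
  simp only [adInv, Ring.lie_def, cubicLin, mul_add, add_mul, mul_sub, sub_mul, mul_smul_comm,
    smul_mul_assoc, mul_assoc, mul_mul_self_of_cube hv, mul_mul_mul_of_cube hv]
  module

theorem eq_zero_of_lie_of_cubicLin {v w : A} (hv : v ^ 3 = v) (hlie : ⁅v, w⁆ = 0)
    (hlin : cubicLin v w = 0) : w = 0 := by
  rw [← lie_adInv hv hlin, adInv, hlie]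
  simp

theorem cubicLin_eq_zero_of_cubicLin_cubicLin {v w : A} (hv : v ^ 3 = v)
    (h : cubicLin v (cubicLin v w) = 0) : cubicLin v w = 0 :=
  eq_zero_of_lie_of_cubicLin hv (lie_cubicLin hv w) h

/-- One step of the recursion for Lax series: the right-hand sides `w` and `-p` of the linear
system for `c` satisfy the compatibility condition coming from the Leibniz rule. -/
theorem exists_lie_eq_and_cubicLin_eq_neg {e w p : A} (he : e ^ 3 = e)
    (h : -⁅e, p⁆ = cubicLin e w) : ∃ c, ⁅e, c⁆ = w ∧ cubicLin e c = -p := by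
  have hw : cubicLin e w = 0 := cubicLin_eq_zero_of_cubicLin_cubicLin he <| by
    rw [← h, ← lie_neg, cubicLin_lie he]
  have hp : p * e = e * p := by
    rw [hw, neg_eq_zero, Ring.lie_def, sub_eq_zero] at h
    exact h.symm
  have hlie : ⁅e, p - (3 / 2 : ℝ) • (e * (e * p))⁆ = 0 := by
    simp only [Ring.lie_def, mul_sub, sub_mul, mul_assoc, mul_smul_comm, smul_mul_assoc, hp,
      sub_self]
  have hlin : cubicLin e (p - (3 / 2 : ℝ) • (e * (e * p))) = -p := by
    simp only [cubicLin, mul_sub, sub_mul, mul_assoc, mul_smul_comm, smul_mul_assoc, hp,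
      mul_mul_mul_of_cube he]
    module
  refine ⟨adInv e w + (p - (3 / 2 : ℝ) • (e * (e * p))), ?_, ?_⟩
  · rw [lie_add, hlie, lie_adInv he hw, add_zero]
  · rw [cubicLin_add, hlin, cubicLin_adInv he, zero_add]

end Cubic

/-! ### The Lax equation for formal power series -/

section Derivations

variable {A : Type*} [Ring A]

/-- The Leibniz rule for an additive endomorphism of a ring. (Mathlib's `Derivation` is restricted
to commutative rings.) -/
def IsDerivation (D : A →+ A) : Prop := ∀ a b, D (a * b) = D a * b + a * D b

namespace IsDerivation

variable {D D' : A →+ A}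

theorem map_mul (hD : IsDerivation D) (a b : A) : D (a * b) = D a * b + a * D b := hD a b

theorem sub (hD : IsDerivation D) (hD' : IsDerivation D') : IsDerivation (D - D') := by
  intro a b
  simp only [AddMonoidHom.sub_apply, hD.map_mul, hD'.map_mul]
  noncomm_ring

theorem mulLeft_comp (hD : IsDerivation D) {c : A} (hc : ∀ a, Commute c a) :
    IsDerivation ((AddMonoidHom.mulLeft c).comp D) := by
  intro a b
  simp only [AddMonoidHom.comp_apply, AddMonoidHom.coe_mulLeft, hD.map_mul, mul_add]
  rw [← mul_assoc c a, (hc a).eq, mul_assoc, mul_assoc]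

theorem map_cube_sub (hD : IsDerivation D) (v : A) : D (v ^ 3 - v) = cubicLin v (D v) := by
  rw [pow_succ, pow_two, map_sub, hD.map_mul, hD.map_mul, cubicLin]
  noncomm_ring

theorem cubicLin_eq_zero (hD : IsDerivation D) {v : A} (hv : v ^ 3 = v) :
    cubicLin v (D v) = 0 := by
  rw [← hD.map_cube_sub, hv, sub_self, map_zero]

theorem map_lie (hD : IsDerivation D) (a b : A) : D ⁅a, b⁆ = ⁅D a, b⁆ + ⁅a, D b⁆ := by
  simp only [Ring.lie_def, map_sub, hD.map_mul]
  abel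

end IsDerivation

/-- The inner derivation `b ↦ ⁅a, b⁆`. -/
def innerDer (a : A) : A →+ A := AddMonoidHom.mulLeft a - AddMonoidHom.mulRight a

theorem innerDer_apply (a b : A) : innerDer a b = ⁅a, b⁆ := rfl

theorem isDerivation_innerDer (a : A) : IsDerivation (innerDer a) := by
  intro b c
  simp only [innerDer_apply, Ring.lie_def]
  noncomm_ring

end Derivations

section Series

variable {A : Type*} [Ring A]

/-- Coefficientwise action of an additive map on power series. -/
def seriesMap {B : Type*} [Ring B] (D : A →+ B) : A⟦X⟧ →+ B⟦X⟧ where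
  toFun f := PowerSeries.mk fun n => D (coeff n f)
  map_zero' := by ext; simp
  map_add' f g := by ext; simp

@[simp] theorem coeff_seriesMap {B : Type*} [Ring B] (D : A →+ B) (f : A⟦X⟧) (n : ℕ) :
    coeff n (seriesMap D f) = D (coeff n f) := by
  rw [seriesMap, AddMonoidHom.coe_mk, ZeroHom.coe_mk, coeff_mk]

theorem IsDerivation.seriesMap {D : A →+ A} (hD : IsDerivation D) :
    IsDerivation (seriesMap D) := by
  intro f g
  ext n
  simp only [map_add, coeff_seriesMap, coeff_mul, map_sum, hD.map_mul, Finset.sum_add_distrib]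

/-- The series `e + z u`. -/
def laxSeries (e u : A) : A⟦X⟧ := C e + X * C u

theorem constantCoeff_laxSeries (e u : A) : constantCoeff (laxSeries e u) = e := by
  simp [laxSeries]

theorem coeff_succ_lie_laxSeries (e u : A) (f : A⟦X⟧) (n : ℕ) :
    coeff (n + 1) ⁅laxSeries e u, f⁆ = ⁅e, coeff (n + 1) f⁆ + ⁅u, coeff n f⁆ := by
  have hcomm : f * (X * C u) = X * (f * C u) := by
    rw [← mul_assoc, ← mul_assoc, (commute_X f).eq]
  simp only [Ring.lie_def, laxSeries, add_mul, mul_add, hcomm, map_sub, map_add, mul_assoc,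
    coeff_succ_X_mul, coeff_C_mul, coeff_mul_C]
  abel

/-- The defect `z D f - ⁅e + z u, f⁆` of the Lax equation. -/
def laxDefect (D : A →+ A) (e u : A) : A⟦X⟧ →+ A⟦X⟧ :=
  (AddMonoidHom.mulLeft X).comp (seriesMap D) - innerDer (laxSeries e u)

theorem laxDefect_apply (D : A →+ A) (e u : A) (f : A⟦X⟧) :
    laxDefect D e u f = X * seriesMap D f - ⁅laxSeries e u, f⁆ := rfl

theorem constantCoeff_laxDefect (D : A →+ A) (e u : A) (f : A⟦X⟧) :
    constantCoeff (laxDefect D e u f) = -⁅e, constantCoeff f⁆ := by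
  simp [laxDefect_apply, Ring.lie_def, constantCoeff_laxSeries]

theorem coeff_succ_laxDefect (D : A →+ A) (e u : A) (f : A⟦X⟧) (n : ℕ) :
    coeff (n + 1) (laxDefect D e u f) =
      D (coeff n f) - ⁅u, coeff n f⁆ - ⁅e, coeff (n + 1) f⁆ := by
  rw [laxDefect_apply, map_sub, coeff_succ_X_mul, coeff_seriesMap, coeff_succ_lie_laxSeries]
  abel

theorem IsDerivation.laxDefect {D : A →+ A} (hD : IsDerivation D) (e u : A) :
    IsDerivation (laxDefect D e u) :=
  (hD.seriesMap.mulLeft_comp fun f => (commute_X f).symm).sub (isDerivation_innerDer _)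

theorem mul_X_pow_mul (f g : A⟦X⟧) (n : ℕ) : f * (X ^ n * g) = X ^ n * (f * g) := by
  rw [← mul_assoc, (commute_X_pow f n).eq, mul_assoc]

theorem laxDefect_X_pow_mul (D : A →+ A) (e u : A) (n : ℕ) (f : A⟦X⟧) :
    laxDefect D e u (X ^ n * f) = X ^ n * laxDefect D e u f := by
  have hD : seriesMap D (X ^ n * f) = X ^ n * seriesMap D f := by
    ext k
    simp only [coeff_seriesMap, coeff_X_pow_mul']
    split_ifs <;> simp
  rw [laxDefect_apply, laxDefect_apply, Ring.lie_def, Ring.lie_def, hD, mul_X_pow_mul,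
    mul_X_pow_mul, mul_sub, mul_sub, mul_assoc]

theorem cubicLin_X_pow_mul (f g : A⟦X⟧) (n : ℕ) :
    cubicLin f (X ^ n * g) = X ^ n * cubicLin f g := by
  simp only [cubicLin, mul_assoc, mul_X_pow_mul, mul_add, mul_sub]

theorem eq_zero_of_X_pow_dvd {f : A⟦X⟧} (h : ∀ n, X ^ n ∣ f) : f = 0 := by
  ext n
  exact X_pow_dvd_iff.1 (h (n + 1)) n n.lt_succ_self

end Series

section LaxSolutions

variable {A : Type*} [Ring A]

/-- A solution `V = e + O(z)` of the Lax equation `z D V = ⁅e + z u, V⁆` with `V³ = V`. The Lax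
equation is recorded by its coefficients of positive order. -/
structure IsLaxSolution (D : A →+ A) (e u : A) (V : A⟦X⟧) : Prop where
  coeff_zero : coeff 0 V = e
  coeff_succ (n : ℕ) : D (coeff n V) - ⁅u, coeff n V⁆ = ⁅e, coeff (n + 1) V⁆
  cube : V ^ 3 = V

variable {D : A →+ A} {e u : A} {V : A⟦X⟧}

theorem IsLaxSolution.constantCoeff_eq (hV : IsLaxSolution D e u V) : constantCoeff V = e := by
  rw [← coeff_zero_eq_constantCoeff_apply, hV.coeff_zero]

theorem IsLaxSolution.pow_three_eq (hV : IsLaxSolution D e u V) : e ^ 3 = e := by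
  rw [← hV.constantCoeff_eq, ← map_pow, hV.cube]

theorem IsLaxSolution.laxDefect_eq_zero (hV : IsLaxSolution D e u V) : laxDefect D e u V = 0 := by
  ext n
  rcases n with _ | n
  · rw [coeff_zero_eq_constantCoeff_apply, constantCoeff_laxDefect, hV.constantCoeff_eq, lie_self,
      neg_zero, map_zero]
  · rw [coeff_succ_laxDefect, hV.coeff_succ, sub_self, map_zero]

theorem isLaxSolution_of_laxDefect_eq_zero (h0 : constantCoeff V = e)
    (hlax : laxDefect D e u V = 0) (hcube : V ^ 3 = V) : IsLaxSolution D e u V where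
  coeff_zero := by rw [coeff_zero_eq_constantCoeff_apply, h0]
  coeff_succ n := by
    rw [← sub_eq_zero, ← coeff_succ_laxDefect, hlax, map_zero]
  cube := hcube

variable [Algebra ℝ A]

/-- The coefficients of `Z` vanish one after the other, since an element that commutes with `e`
and is annihilated by `cubicLin e` vanishes. -/
theorem eq_zero_of_laxDefect_eq_zero (he : e ^ 3 = e) {V' Z : A⟦X⟧} (hV : constantCoeff V = e)
    (hV' : constantCoeff V' = e) (hlax : laxDefect D e u Z = 0)
    (hcube : V' * V' * Z + V' * Z * V + Z * V * V = Z) : Z = 0 := by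
  refine eq_zero_of_X_pow_dvd fun n => ?_
  induction n with
  | zero => exact ⟨Z, by rw [pow_zero, one_mul]⟩
  | succ n ih =>
    obtain ⟨Y, rfl⟩ := ih
    rw [pow_succ]
    refine mul_dvd_mul_left _ (X_dvd_iff.2 (eq_zero_of_lie_of_cubicLin he ?_ ?_))
    · rw [laxDefect_X_pow_mul] at hlax
      have hY : laxDefect D e u Y = 0 := X_pow_mul_cancel (hlax.trans (mul_zero _).symm)
      rw [← neg_eq_zero, ← constantCoeff_laxDefect D e u, hY, map_zero]
    · have hY : V' * V' * Y + V' * Y * V + Y * V * V = Y := X_pow_mul_cancel <| by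
        simpa only [mul_assoc, mul_X_pow_mul, mul_add] using hcube
      rw [cubicLin, sub_eq_zero]
      simpa only [map_add, map_mul, hV, hV'] using congrArg constantCoeff hY

theorem IsLaxSolution.unique {V' : A⟦X⟧} (hV : IsLaxSolution D e u V)
    (hV' : IsLaxSolution D e u V') : V = V' := by
  refine sub_eq_zero.1 (eq_zero_of_laxDefect_eq_zero (D := D) (u := u) hV.pow_three_eq
    hV.constantCoeff_eq hV'.constantCoeff_eq ?_ ?_)
  · rw [map_sub, hV.laxDefect_eq_zero, hV'.laxDefect_eq_zero, sub_zero]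
  · calc _ = V ^ 3 - V' ^ 3 := by noncomm_ring
      _ = V - V' := by rw [hV.cube, hV'.cube]

/-- A solution of the Lax equation and of `V³ = V` up to terms of order `z ^ n`. -/
structure IsApproxLaxSolution (D : A →+ A) (e u : A) (n : ℕ) (V : A⟦X⟧) : Prop where
  constantCoeff_eq : constantCoeff V = e
  dvd_laxDefect : X ^ n ∣ laxDefect D e u V
  dvd_cube : X ^ n ∣ V ^ 3 - V

omit [Algebra ℝ A] in
theorem isApproxLaxSolution_one_C (D : A →+ A) (u : A) (he : e ^ 3 = e) :
    IsApproxLaxSolution D e u 1 (C e) where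
  constantCoeff_eq := constantCoeff_C e
  dvd_laxDefect := by
    rw [pow_one, X_dvd_iff, constantCoeff_laxDefect, constantCoeff_C, lie_self, neg_zero]
  dvd_cube := by rw [← map_pow, he, sub_self]; exact dvd_zero _

omit [Algebra ℝ A] in
theorem add_X_pow_mul_pow_three_sub (V Y : A⟦X⟧) (n : ℕ) :
    (V + X ^ n * Y) ^ 3 - (V + X ^ n * Y) = (V ^ 3 - V) +
      X ^ n * (cubicLin V Y + X ^ n * (Y * Y * V + Y * V * Y + V * Y * Y + X ^ n * Y ^ 3)) := by
  simp only [pow_succ _ 2, pow_two (V + _), pow_two V, pow_two Y, cubicLin, add_mul, mul_add,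
    mul_sub, mul_assoc, mul_X_pow_mul]
  abel

omit [Algebra ℝ A] in
theorem X_pow_dvd_pow_three_sub {n : ℕ} {V' : A⟦X⟧} (h : X ^ n ∣ V' - V)
    (hV : X ^ n ∣ V ^ 3 - V) : X ^ n ∣ V' ^ 3 - V' := by
  obtain ⟨Y, hY⟩ := h
  rw [sub_eq_iff_eq_add'.1 hY, add_X_pow_mul_pow_three_sub]
  exact dvd_add hV (dvd_mul_right _ _)

theorem IsApproxLaxSolution.exists_succ (hD : IsDerivation D) (he : e ^ 3 = e) {n : ℕ}
    (hV : IsApproxLaxSolution D e u (n + 1) V) :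
    ∃ V', IsApproxLaxSolution D e u (n + 2) V' ∧ X ^ (n + 1) ∣ V' - V := by
  obtain ⟨w, hw⟩ := hV.dvd_laxDefect
  obtain ⟨p, hp⟩ := hV.dvd_cube
  have hwp : laxDefect D e u p = cubicLin V w := by
    have := (hD.laxDefect e u).map_cube_sub V
    rw [hp, hw, laxDefect_X_pow_mul, cubicLin_X_pow_mul] at this
    exact X_pow_mul_cancel this
  obtain ⟨c, hcw, hcp⟩ := exists_lie_eq_and_cubicLin_eq_neg he
    (w := constantCoeff w) (p := constantCoeff p) <| by
      rw [← constantCoeff_laxDefect D e u, hwp, map_cubicLin, hV.constantCoeff_eq]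
  refine ⟨V + X ^ (n + 1) * C c, ⟨?_, ?_, ?_⟩, by rw [add_sub_cancel_left]; exact dvd_mul_right _ _⟩
  · simp [hV.constantCoeff_eq]
  · rw [map_add, hw, laxDefect_X_pow_mul, ← mul_add, pow_succ]
    refine mul_dvd_mul_left _ (X_dvd_iff.2 ?_)
    rw [map_add, constantCoeff_laxDefect, constantCoeff_C, hcw, add_neg_cancel]
  · rw [add_X_pow_mul_pow_three_sub, hp, ← mul_add, pow_succ]
    refine mul_dvd_mul_left _ (X_dvd_iff.2 ?_)
    rw [map_add, map_add, map_cubicLin, constantCoeff_C, hV.constantCoeff_eq, hcp]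
    simp

omit [Algebra ℝ A] in
theorem exists_X_pow_dvd_sub_of_X_pow_dvd_sub_succ (s : ℕ → A⟦X⟧)
    (hs : ∀ n, X ^ (n + 1) ∣ s (n + 1) - s n) : ∃ V : A⟦X⟧, ∀ n, X ^ (n + 1) ∣ V - s n := by
  have hcoeff (j k : ℕ) : coeff j (s (j + k)) = coeff j (s j) := by
    induction k with
    | zero => rfl
    | succ k ih =>
      rw [← ih, ← sub_eq_zero, ← map_sub]
      exact X_pow_dvd_iff.1 (hs (j + k)) j (by omega)
  refine ⟨PowerSeries.mk fun n => coeff n (s n), fun n => X_pow_dvd_iff.2 fun j hj => ?_⟩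
  obtain ⟨k, rfl⟩ := Nat.exists_eq_add_of_le (Nat.lt_succ_iff.1 hj)
  rw [map_sub, coeff_mk, hcoeff, sub_self]

theorem exists_isLaxSolution (hD : IsDerivation D) (u : A) (he : e ^ 3 = e) :
    ∃ V, IsLaxSolution D e u V := by
  choose next hnext using fun (n : ℕ) (V : {V // IsApproxLaxSolution D e u (n + 1) V}) =>
    V.2.exists_succ hD he
  let s : (n : ℕ) → {V // IsApproxLaxSolution D e u (n + 1) V} := fun n =>
    n.rec ⟨C e, isApproxLaxSolution_one_C D u he⟩ fun n V => ⟨next n V, (hnext n V).1⟩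
  obtain ⟨V, hV⟩ := exists_X_pow_dvd_sub_of_X_pow_dvd_sub_succ (fun n => (s n).1)
    fun n => (hnext n (s n)).2
  have hlax (n : ℕ) : X ^ (n + 1) ∣ laxDefect D e u V := by
    obtain ⟨Y, hY⟩ := hV n
    rw [sub_eq_iff_eq_add'.1 hY, map_add, laxDefect_X_pow_mul]
    exact dvd_add (s n).2.dvd_laxDefect (dvd_mul_right _ _)
  have hcube (n : ℕ) : X ^ (n + 1) ∣ V ^ 3 - V := X_pow_dvd_pow_three_sub (hV n) (s n).2.dvd_cube
  refine ⟨V, isLaxSolution_of_laxDefect_eq_zero ?_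
    (eq_zero_of_X_pow_dvd fun n => (pow_dvd_pow X n.le_succ).trans (hlax n))
    (sub_eq_zero.1 (eq_zero_of_X_pow_dvd fun n => (pow_dvd_pow X n.le_succ).trans (hcube n)))⟩
  have h0 : constantCoeff (V - (s 0).1) = 0 := X_dvd_iff.1 (pow_one (X : A⟦X⟧) ▸ hV 0)
  rw [map_sub, (s 0).2.constantCoeff_eq, sub_eq_zero] at h0
  exact h0

end LaxSolutions

section Symmetries

variable {A B : Type*} [Ring A] [Ring B]

theorem IsLaxSolution.map {D : A →+ A} {D' : B →+ B} {e u : A} {V : A⟦X⟧}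
    (hV : IsLaxSolution D e u V) (φ : A →+* B) (hφ : ∀ a, φ (D a) = D' (φ a)) :
    IsLaxSolution D' (φ e) (φ u) (PowerSeries.map φ V) where
  coeff_zero := by rw [coeff_map, hV.coeff_zero]
  coeff_succ n := by
    simpa only [coeff_map, Ring.lie_def, map_sub, map_mul, hφ] using congrArg φ (hV.coeff_succ n)
  cube := by rw [← map_pow, hV.cube]

/-- The substitution `z ↦ -z` in power series. (Mathlib's `PowerSeries.rescale` is restricted to
commutative coefficient rings.) -/
def negVar : A⟦X⟧ →+* A⟦X⟧ where
  toFun f := PowerSeries.mk fun n => (-1 : ℤ) ^ n • coeff n f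
  map_zero' := by ext; simp
  map_one' := by
    ext n
    rw [coeff_mk, coeff_one]
    split_ifs with hn <;> simp [hn]
  map_add' f g := by ext; simp
  map_mul' f g := by
    ext n
    rw [coeff_mk, coeff_mul, coeff_mul, Finset.smul_sum]
    refine Finset.sum_congr rfl fun x hx => ?_
    rw [coeff_mk, coeff_mk, smul_mul_smul_comm, ← pow_add,
      Finset.HasAntidiagonal.mem_antidiagonal.1 hx]

theorem coeff_negVar (f : A⟦X⟧) (n : ℕ) : coeff n (negVar f) = (-1 : ℤ) ^ n • coeff n f := by
  rw [negVar, RingHom.coe_mk, MonoidHom.coe_mk, OneHom.coe_mk, coeff_mk]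

variable {D : A →+ A} {e u : A} {V : A⟦X⟧}

theorem IsLaxSolution.neg_negVar (hV : IsLaxSolution D e u V) :
    IsLaxSolution D (-e) u (-negVar V) where
  coeff_zero := by rw [map_neg, coeff_negVar, hV.coeff_zero, pow_zero, one_smul]
  coeff_succ n := by
    simp only [map_neg, coeff_negVar, map_zsmul, lie_neg, neg_lie, lie_zsmul, pow_succ, mul_neg,
      mul_one, neg_smul, neg_neg, ← hV.coeff_succ]
    rw [smul_neg, smul_sub, neg_sub']
  cube := by rw [Odd.neg_pow (by decide), ← map_pow, hV.cube]

/-- The adjoint `∑ aₙ* zⁿ` of a power series `∑ aₙ zⁿ`. -/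
def seriesStar [StarRing A] (f : A⟦X⟧) : A⟦X⟧ := PowerSeries.mk fun n => star (coeff n f)

theorem coeff_seriesStar [StarRing A] (f : A⟦X⟧) (n : ℕ) :
    coeff n (seriesStar f) = star (coeff n f) := by
  rw [seriesStar, coeff_mk]

theorem seriesStar_mul [StarRing A] (f g : A⟦X⟧) :
    seriesStar (f * g) = seriesStar g * seriesStar f := by
  ext n
  rw [coeff_seriesStar, coeff_mul, coeff_mul, star_sum, ← Finset.Nat.sum_antidiagonal_swap]
  simp only [star_mul, coeff_seriesStar, Prod.fst_swap, Prod.snd_swap]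

theorem IsLaxSolution.neg_star [StarRing A] (hV : IsLaxSolution D e u V)
    (hD : ∀ a, star (D a) = D (star a)) :
    IsLaxSolution D (-star e) (-star u) (-seriesStar V) where
  coeff_zero := by rw [map_neg, coeff_seriesStar, hV.coeff_zero]
  coeff_succ n := by
    have h := congrArg star (hV.coeff_succ n)
    simp only [Ring.lie_def, star_sub, star_mul, hD] at h
    simp only [map_neg, coeff_seriesStar, neg_lie, lie_neg, neg_neg]
    simp only [Ring.lie_def]
    linear_combination (norm := abel) -h
  cube := by
    rw [Odd.neg_pow (by decide), pow_succ, pow_two, ← seriesStar_mul, ← seriesStar_mul,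
      ← mul_assoc, ← pow_two, ← pow_succ, hV.cube]

variable [Algebra ℝ A]

theorem IsLaxSolution.map_coeff_eq (hV : IsLaxSolution D e u V) (φ : A →+* A)
    (hD : ∀ a, φ (D a) = D (φ a)) (hφe : φ e = -e) (hφu : φ u = u) (n : ℕ) :
    φ (coeff n V) = (-1 : ℤ) ^ (n + 1) • coeff n V := by
  have hmap := hV.neg_negVar.map φ hD
  rw [map_neg, hφe, neg_neg, hφu] at hmap
  have hcoeff : coeff n V = (-1 : ℤ) ^ (n + 1) • φ (coeff n V) := by
    conv_lhs => rw [hV.unique hmap]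
    rw [coeff_map, map_neg, map_neg, coeff_negVar, map_zsmul, pow_succ, mul_neg_one, neg_smul]
  conv_rhs => rw [hcoeff]
  rw [smul_smul, ← mul_pow, neg_one_mul, neg_neg, one_pow, one_smul]

theorem IsLaxSolution.star_coeff_eq [StarRing A] (hV : IsLaxSolution D e u V)
    (hD : ∀ a, star (D a) = D (star a)) (hse : star e = e) (hsu : star u = -u) (n : ℕ) :
    star (coeff n V) = (-1 : ℤ) ^ n • coeff n V := by
  have hstar := (hV.neg_star hD).neg_negVar
  rw [neg_neg, hse, hsu, neg_neg, map_neg, neg_neg] at hstar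
  have hcoeff : coeff n V = (-1 : ℤ) ^ n • star (coeff n V) := by
    conv_lhs => rw [hV.unique hstar]
    rw [coeff_negVar, coeff_seriesStar]
  conv_rhs => rw [hcoeff]
  rw [smul_smul, ← mul_pow, neg_one_mul, neg_neg, one_pow, one_smul]

variable [Algebra ℝ B]

omit [Algebra ℝ A] in
theorem IsLaxSolution.map_coeff_succ_eq_zero {D' : B →+ B} (hV : IsLaxSolution D e u V)
    (φ : A →+* B) (hD : ∀ a, φ (D a) = D' (φ a)) (hφe : D' (φ e) = 0) (hφu : φ u = 0) (n : ℕ) :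
    φ (coeff (n + 1) V) = 0 := by
  have hmap := hV.map φ hD
  rw [hφu] at hmap
  have hconst : IsLaxSolution D' (φ e) 0 (C (φ e)) := by
    refine ⟨coeff_zero_C _, fun n => ?_, by rw [← map_pow, ← map_pow, hV.pow_three_eq]⟩
    have hDC : D' (coeff n (C (φ e))) = 0 := by
      rw [coeff_C, apply_ite D', hφe, map_zero, ite_self]
    rw [hDC, coeff_C_of_ne_zero n.succ_ne_zero, zero_lie, lie_zero, sub_self]
  rw [← coeff_map, hmap.unique hconst, coeff_C_of_ne_zero n.succ_ne_zero]

end Symmetries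

section Flows

variable {A : Type*} [Ring A] {D δ δ' : A →+ A} {e u : A} {V : A⟦X⟧}

theorem seriesMap_X_mul (δ : A →+ A) (f : A⟦X⟧) : seriesMap δ (X * f) = X * seriesMap δ f := by
  ext (_ | n)
  · simp
  · rw [coeff_seriesMap, coeff_succ_X_mul, coeff_succ_X_mul, coeff_seriesMap]

theorem seriesMap_C (δ : A →+ A) (a : A) : seriesMap δ (C a) = C (δ a) := by
  ext n
  rw [coeff_seriesMap, coeff_C, coeff_C, apply_ite δ, map_zero]

theorem IsLaxSolution.X_mul_seriesMap (hV : IsLaxSolution D e u V) :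
    X * seriesMap D V = ⁅laxSeries e u, V⁆ :=
  sub_eq_zero.1 hV.laxDefect_eq_zero

theorem IsLaxSolution.laxDefect_seriesMap (hV : IsLaxSolution D e u V) (hδ : IsDerivation δ)
    (hDδ : ∀ a, D (δ a) = δ (D a)) (hδe : δ e = 0) :
    laxDefect D e u (seriesMap δ V) = ⁅X * C (δ u), V⁆ := by
  have hlax := congrArg (seriesMap δ) hV.X_mul_seriesMap
  have hL : seriesMap δ (laxSeries e u) = X * C (δ u) := by
    rw [laxSeries, map_add, seriesMap_X_mul, seriesMap_C, seriesMap_C, hδe, map_zero, zero_add]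
  have hcomm : seriesMap δ (seriesMap D V) = seriesMap D (seriesMap δ V) := by
    ext n
    simp only [coeff_seriesMap, hDδ]
  rw [seriesMap_X_mul, hcomm, hδ.seriesMap.map_lie, hL] at hlax
  rw [laxDefect_apply, hlax, add_sub_cancel_right]

theorem IsLaxSolution.laxDefect_trunc (hV : IsLaxSolution D e u V) (K : ℕ) :
    laxDefect D e u (trunc (K + 1) V : A⟦X⟧) = X ^ (K + 1) * C ⁅e, coeff (K + 1) V⁆ := by
  ext (_ | n)
  · rw [coeff_zero_eq_constantCoeff_apply, constantCoeff_laxDefect,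
      ← coeff_zero_eq_constantCoeff_apply, Polynomial.coeff_coe, coeff_trunc,
      if_pos K.succ_pos, hV.coeff_zero, lie_self, neg_zero]
    simp
  · rw [coeff_succ_laxDefect, Polynomial.coeff_coe, Polynomial.coeff_coe, coeff_trunc, coeff_trunc,
      coeff_X_pow_mul', coeff_C]
    rcases lt_trichotomy n K with hn | rfl | hn
    · rw [if_pos (by lia), if_pos (by lia), if_neg (by lia), hV.coeff_succ, sub_self]
    · simp [hV.coeff_succ]
    · rw [if_neg (by lia), if_neg (by lia), if_pos (by lia), if_neg (by lia)]
      simp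

variable [Algebra ℝ A]

/-- The difference of the two sides is the value at `V` of a derivation, so `V ^ 3 = V` forces it
into the kernel of `cubicLin V`, and the Lax equation determines such a series. -/
theorem IsLaxSolution.X_pow_mul_seriesMap_eq (hD : IsDerivation D)
    (hV : IsLaxSolution D e u V) (hδ : IsDerivation δ) (hDδ : ∀ a, D (δ a) = δ (D a))
    (hδe : δ e = 0) {K : ℕ} (hδu : δ u = ⁅e, coeff (K + 1) V⁆) :
    X ^ K * seriesMap δ V = ⁅(trunc (K + 1) V : A⟦X⟧), V⁆ := by
  have hdiff : IsDerivation ((AddMonoidHom.mulLeft (X ^ K : A⟦X⟧)).comp (seriesMap δ) -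
      innerDer (trunc (K + 1) V : A⟦X⟧)) :=
    (hδ.seriesMap.mulLeft_comp fun f => (commute_X_pow f K).symm).sub (isDerivation_innerDer _)
  have hlin := hdiff.cubicLin_eq_zero hV.cube
  refine sub_eq_zero.1 (eq_zero_of_laxDefect_eq_zero (D := D) (u := u) hV.pow_three_eq
    hV.constantCoeff_eq hV.constantCoeff_eq ?_ (sub_eq_zero.1 hlin))
  rw [map_sub, laxDefect_X_pow_mul, hV.laxDefect_seriesMap hδ hDδ hδe,
    (hD.laxDefect e u).map_lie, hV.laxDefect_trunc, hV.laxDefect_eq_zero, lie_zero, add_zero,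
    ← hδu, pow_succ, Ring.lie_def, Ring.lie_def, mul_sub]
  simp only [mul_assoc, mul_X_pow_mul, sub_self]

theorem IsLaxSolution.deriv_coeff (hD : IsDerivation D)
    (hV : IsLaxSolution D e u V) (hδ : IsDerivation δ) (hDδ : ∀ a, D (δ a) = δ (D a))
    (hδe : δ e = 0) {K : ℕ} (hδu : δ u = ⁅e, coeff (K + 1) V⁆) (n : ℕ) :
    δ (coeff n V) = ∑ j ∈ Finset.range (K + 1), ⁅coeff j V, coeff (n + K - j) V⁆ := by
  have hcoeff := congrArg (coeff (n + K)) (hV.X_pow_mul_seriesMap_eq hD hδ hDδ hδe hδu)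
  rw [coeff_X_pow_mul, coeff_seriesMap, Ring.lie_def, map_sub, coeff_mul,
    coeff_mul, ← Finset.Nat.sum_antidiagonal_swap (f := fun x => coeff x.1 V * _),
    ← Finset.sum_sub_distrib, Finset.Nat.sum_antidiagonal_eq_sum_range_succ_mk] at hcoeff
  rw [hcoeff]
  have hsub : Finset.range (K + 1) ⊆ Finset.range (n + K + 1) :=
    Finset.range_subset_range.2 (by lia)
  refine (Finset.sum_subset_zero_on_sdiff hsub (fun j hj => ?_) fun j hj => ?_).symm
  · rw [Finset.mem_sdiff, Finset.mem_range, Finset.mem_range] at hj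
    simp only [Prod.swap_prod_mk, Polynomial.coeff_coe, coeff_trunc, if_neg hj.2, zero_mul,
      mul_zero, sub_zero]
  · simp only [Prod.swap_prod_mk, Polynomial.coeff_coe, coeff_trunc,
      if_pos (Finset.mem_range.1 hj), Ring.lie_def]

omit [Algebra ℝ A] in
theorem sum_range_lie_coeff_symm (f : A⟦X⟧) (a b : ℕ) :
    ∑ j ∈ Finset.range (a + 1), ⁅coeff j f, coeff (a + b + 1 - j) f⁆ =
      ∑ j ∈ Finset.range (b + 1), ⁅coeff j f, coeff (a + b + 1 - j) f⁆ := by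
  have htotal : ∑ j ∈ Finset.range (a + 1 + (b + 1)), ⁅coeff j f, coeff (a + b + 1 - j) f⁆ = 0 := by
    rw [show a + 1 + (b + 1) = (a + b + 1).succ by lia,
      ← Finset.Nat.sum_antidiagonal_eq_sum_range_succ fun i j => ⁅coeff i f, coeff j f⁆]
    simp only [Ring.lie_def, Finset.sum_sub_distrib]
    rw [← Finset.Nat.sum_antidiagonal_swap]
    exact sub_self _
  have hupper : ∑ j ∈ Finset.range (b + 1),
      ⁅coeff (a + 1 + j) f, coeff (a + b + 1 - (a + 1 + j)) f⁆ =
      -∑ j ∈ Finset.range (b + 1), ⁅coeff j f, coeff (a + b + 1 - j) f⁆ := by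
    rw [← Finset.sum_range_reflect, ← Finset.sum_neg_distrib]
    refine Finset.sum_congr rfl fun j hj => ?_
    rw [Finset.mem_range] at hj
    rw [← lie_skew, show a + 1 + (b + 1 - 1 - j) = a + b + 1 - j by lia,
      show a + b + 1 - (a + b + 1 - j) = j by lia]
  rw [Finset.sum_range_add, hupper, ← sub_eq_add_neg, sub_eq_zero] at htotal
  exact htotal

theorem IsLaxSolution.deriv_coeff_comm (hD : IsDerivation D) (hV : IsLaxSolution D e u V)
    (hδ : IsDerivation δ) (hδ' : IsDerivation δ') (hDδ : ∀ a, D (δ a) = δ (D a))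
    (hDδ' : ∀ a, D (δ' a) = δ' (D a)) (hδe : δ e = 0) (hδe' : δ' e = 0) {K N : ℕ}
    (hδu : δ u = ⁅e, coeff (K + 1) V⁆) (hδu' : δ' u = ⁅e, coeff (N + 1) V⁆) :
    δ (coeff (N + 1) V) = δ' (coeff (K + 1) V) := by
  rw [hV.deriv_coeff hD hδ hDδ hδe hδu, hV.deriv_coeff hD hδ' hDδ' hδe' hδu',
    show N + 1 + K = K + N + 1 by lia, show K + 1 + N = K + N + 1 by lia]
  exact sum_range_lie_coeff_symm V K N

end Flows

section Trace

variable {A B : Type*} [Ring A] [AddCommGroup B] {D δ : A →+ A} {e u : A} {V : A⟦X⟧}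

theorem trace_mul_sub_trace_mul_eq_trace_derivation {τ : A →+ B}
    (hτ : ∀ a b, τ (a * b) = τ (b * a)) {N : A →+ A} (hN : IsDerivation N) {v p q a b : A}
    (hv : N v = 0) (ha : N ⁅v, p⁆ = ⁅a, v⁆) (hb : N ⁅v, q⁆ = ⁅b, v⁆) :
    τ (⁅v, p⁆ * b) - τ (⁅v, q⁆ * a) = τ (N (p * v * q - q * v * p)) := by
  rw [hN.map_lie, hv, zero_lie, zero_add] at ha hb
  have hpb : τ (⁅v, p⁆ * b) = τ (p * ⁅v, N q⁆) := by
    rw [hb]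
    simp only [Ring.lie_def, sub_mul, mul_sub, map_sub]
    rw [mul_assoc, hτ v]
    simp only [mul_assoc]
  have hqa : τ (⁅v, q⁆ * a) = τ (q * ⁅v, N p⁆) := by
    rw [ha]
    simp only [Ring.lie_def, sub_mul, mul_sub, map_sub]
    rw [mul_assoc, hτ v]
    simp only [mul_assoc]
  rw [hpb, hqa]
  simp only [map_sub, Ring.lie_def, hN.map_mul, hv, mul_sub, map_add, mul_zero, add_zero,
    ← mul_assoc]
  rw [hτ (p * N q) v, hτ (q * N p) v, mul_assoc (N p), hτ (N p), mul_assoc (N q), hτ (N q)]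
  simp only [← mul_assoc]
  abel

theorem trace_coeff_mul_comm {t : A →+ B} (ht : ∀ a b, t (a * b) = t (b * a)) (n : ℕ)
    (f g : A⟦X⟧) : t (coeff n (f * g)) = t (coeff n (g * f)) := by
  rw [coeff_mul, coeff_mul, map_sum, map_sum, ← Finset.Nat.sum_antidiagonal_swap]
  exact Finset.sum_congr rfl fun x _ => ht _ _

/-- The Euler operator `z d/dz` on power series. -/
def eulerSeries : A⟦X⟧ →+ A⟦X⟧ where
  toFun f := PowerSeries.mk fun n => n • coeff n f
  map_zero' := by ext; simp
  map_add' f g := by ext; simp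

theorem coeff_eulerSeries (f : A⟦X⟧) (n : ℕ) : coeff n (eulerSeries f) = n • coeff n f := by
  rw [eulerSeries, AddMonoidHom.coe_mk, ZeroHom.coe_mk, coeff_mk]

theorem isDerivation_eulerSeries : IsDerivation (eulerSeries (A := A)) := by
  intro f g
  ext n
  rw [map_add, coeff_eulerSeries, coeff_mul, coeff_mul, coeff_mul, Finset.smul_sum,
    ← Finset.sum_add_distrib]
  refine Finset.sum_congr rfl fun x hx => ?_
  rw [coeff_eulerSeries, coeff_eulerSeries, smul_mul_assoc, mul_smul_comm, ← add_smul,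
    Finset.HasAntidiagonal.mem_antidiagonal.1 hx]

theorem eulerSeries_X_mul (f : A⟦X⟧) : eulerSeries (X * f) = X * f + X * eulerSeries f := by
  ext (_ | n)
  · simp [coeff_eulerSeries]
  · rw [coeff_eulerSeries, map_add, coeff_succ_X_mul, coeff_succ_X_mul, coeff_eulerSeries,
      succ_nsmul']

theorem eulerSeries_C (a : A) : eulerSeries (C a) = 0 := by
  ext (_ | n) <;> simp [coeff_eulerSeries, coeff_C]

theorem IsLaxSolution.laxDefect_eulerSeries (hV : IsLaxSolution D e u V) :
    laxDefect D e u (eulerSeries V) = ⁅-C e, V⁆ := by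
  have hlax := congrArg eulerSeries hV.X_mul_seriesMap
  have hL : eulerSeries (laxSeries e u) = X * C u := by
    rw [laxSeries, map_add, eulerSeries_C, eulerSeries_X_mul, eulerSeries_C, mul_zero, zero_add,
      add_zero]
  have hcomm : eulerSeries (seriesMap D V) = seriesMap D (eulerSeries V) := by
    ext n
    simp only [coeff_eulerSeries, coeff_seriesMap, map_nsmul]
  rw [eulerSeries_X_mul, hcomm, isDerivation_eulerSeries.map_lie, hL, hV.X_mul_seriesMap] at hlax
  rw [laxDefect_apply, eq_sub_of_add_eq' hlax, laxSeries]
  simp only [add_lie, neg_lie]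
  abel

variable [Algebra ℝ A]

/-- Both `δ V` and `z dV/dz` are commutators with `V`, because `V ^ 3 = V`; the identity is
`trace_mul_sub_trace_mul_eq_trace_derivation` for the Lax derivation and these two commutators. -/
theorem IsLaxSolution.trace_identity {t : A →+ B} (ht : ∀ a b, t (a * b) = t (b * a))
    (hD : IsDerivation D) (hV : IsLaxSolution D e u V) (hδ : IsDerivation δ)
    (hDδ : ∀ a, D (δ a) = δ (D a)) (hδe : δ e = 0) (n : ℕ) :
    ∃ g : A, t (δ (coeff (n + 1) V) * e) + n • t (coeff n V * δ u) = t (D g) := by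
  have hp := lie_adInv hV.cube (hδ.seriesMap.cubicLin_eq_zero hV.cube)
  have hq := lie_adInv hV.cube (isDerivation_eulerSeries.cubicLin_eq_zero hV.cube)
  set p := adInv V (seriesMap δ V)
  set q := adInv V (eulerSeries V)
  have key := trace_mul_sub_trace_mul_eq_trace_derivation
    (τ := t.comp (coeff (R := A) (n + 1)).toAddMonoidHom)
    (trace_coeff_mul_comm ht (n + 1)) (hD.laxDefect e u) hV.laxDefect_eq_zero
    (by rw [hp]; exact hV.laxDefect_seriesMap hδ hDδ hδe)
    (by rw [hq]; exact hV.laxDefect_eulerSeries)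
  simp only [AddMonoidHom.comp_apply, LinearMap.toAddMonoidHom_coe, hp, hq] at key
  generalize p * V * q - q * V * p = G at key
  have hlie (a b : A) : t ⁅a, b⁆ = 0 := by rw [Ring.lie_def, map_sub, ht, sub_self]
  have hXC : eulerSeries V * (X * C (δ u)) = X * (eulerSeries V * C (δ u)) := by
    rw [← mul_assoc, (commute_X _).eq, mul_assoc]
  rw [coeff_succ_laxDefect, hXC, mul_neg, map_neg, coeff_mul_C, coeff_succ_X_mul, coeff_mul_C,
    coeff_seriesMap, coeff_eulerSeries, smul_mul_assoc, map_nsmul, map_neg, map_sub, map_sub,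
    hlie, hlie, sub_zero, sub_zero] at key
  refine ⟨-coeff n G, ?_⟩
  rw [map_neg, map_neg, ← key]
  abel

end Trace

/-! ### The kernel of the total derivative and functionals -/

section Kernel

variable {m : ℕ} {W W' W'' : Type} [NormedAddCommGroup W] [NormedSpace ℝ W]
  [NormedAddCommGroup W'] [NormedSpace ℝ W'] [NormedAddCommGroup W''] [NormedSpace ℝ W'']

theorem Dx_add {f g : Jet m → W} (hf : IsLocal f) (hg : IsLocal g) :
    Dx (fun p => f p + g p) = fun p => Dx f p + Dx g p :=
  funext fun p => hf.lineDeriv_add hg p _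

theorem Dx_clm (L : W →L[ℝ] W') {f : Jet m → W} (hf : IsLocal f) :
    Dx (fun p => L (f p)) = fun p => L (Dx f p) :=
  funext fun p => hf.lineDeriv_clm L p _

theorem Dx_bilin (B : W →L[ℝ] W' →L[ℝ] W'') {f : Jet m → W} {g : Jet m → W'}
    (hf : IsLocal f) (hg : IsLocal g) :
    Dx (fun p => B (f p) (g p)) = fun p => B (Dx f p) (g p) + B (f p) (Dx g p) :=
  funext fun p => hf.lineDeriv_bilin B hg p _

theorem Dx_const_smul (c : ℝ) {f : Jet m → W} (hf : IsLocal f) :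
    Dx (fun p => c • f p) = fun p => c • Dx f p :=
  Dx_clm (c • ContinuousLinearMap.id ℝ W) hf

theorem Dx_neg {f : Jet m → W} (hf : IsLocal f) : Dx (fun p => -f p) = fun p => -Dx f p :=
  Dx_clm (-ContinuousLinearMap.id ℝ W) hf

theorem Dx_sub {f g : Jet m → W} (hf : IsLocal f) (hg : IsLocal g) :
    Dx (fun p => f p - g p) = fun p => Dx f p - Dx g p := by
  simp only [sub_eq_add_neg]
  rw [Dx_add hf hg.neg, Dx_neg hg]

theorem Dx_const (c : W) : Dx (fun _ : Jet m => c) = fun _ => 0 := by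
  funext p
  simp [Dx, lineDeriv]

/-- The jet with value `v` of the `k`-th derivative and all other components zero. -/
def jetSingle (k : ℕ) (v : Val m) : Jet m := (0, Pi.single k v)

theorem jetSingle_add (k : ℕ) (v w : Val m) :
    jetSingle k (v + w) = jetSingle k v + jetSingle k w := by
  simp [jetSingle, Pi.single_add]

theorem jetProj_jetSingle {k l : ℕ} (hkl : k ≤ l) (v : Val m) :
    jetProj m k (jetSingle l v) = 0 :=
  Prod.ext rfl (funext fun i => Pi.single_eq_of_ne (i.2.trans_le hkl).ne _)

theorem IsLocalOfOrder.add_jetSingle {k l : ℕ} (hkl : k ≤ l) {f : Jet m → W}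
    (hf : IsLocalOfOrder k f) (p : Jet m) (v : Val m) : f (p + jetSingle l v) = f p := by
  obtain ⟨F, -, rfl⟩ := hf
  simp only [map_add, jetProj_jetSingle hkl, add_zero]

theorem Dx_add_jetSingle {k : ℕ} {g : Jet m → W} (hg : IsLocalOfOrder (k + 1) g) (p : Jet m)
    (v : Val m) : Dx g (p + jetSingle (k + 1) v) = Dx g p + lineDeriv ℝ g p (jetSingle k v) := by
  obtain ⟨F, hF, rfl⟩ := hg
  have hshift : (1, fun j => (p + jetSingle (k + 1) v).2 (j + 1)) =
      ((1, fun j => p.2 (j + 1)) : Jet m) + jetSingle k v := by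
    refine Prod.ext (by simp [jetSingle]) (funext fun j => ?_)
    simp [jetSingle, Pi.single_apply]
  rw [Dx, Dx, lineDeriv_comp_jetProj hF, lineDeriv_comp_jetProj hF, lineDeriv_comp_jetProj hF,
    hshift, map_add, map_add, map_add, jetProj_jetSingle le_rfl, add_zero]

theorem IsLocal.add_eq_of_lineDeriv_eq_zero {g : Jet m → W} (hg : IsLocal g) {v : Jet m}
    (h : ∀ p, lineDeriv ℝ g p v = 0) (p : Jet m) : g (p + v) = g p := by
  obtain ⟨k, F, hF, rfl⟩ := isLocal_iff_exists_isLocalOfOrder.1 hg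
  have hderiv (t : ℝ) : HasDerivAt (fun t : ℝ => F (jetProj m k (p + t • v))) 0 t := by
    rw [← h (p + t • v), lineDeriv_comp_jetProj hF]
    simp only [map_add, map_smul]
    simpa only [one_smul, id_eq, Function.comp_def] using
      (hF.differentiable (by simp) _).hasFDerivAt.comp_hasDerivAt t
        (((hasDerivAt_id t).smul_const (jetProj m k v)).const_add (jetProj m k p))
  simpa using is_const_of_deriv_eq_zero (fun t => (hderiv t).differentiableAt)
    (fun t => (hderiv t).deriv) 1 0

theorem IsLocalOfOrder.of_add_jetSingle {k : ℕ} {g : Jet m → W} (hg : IsLocalOfOrder (k + 1) g)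
    (h : ∀ p v, g (p + jetSingle k v) = g p) : IsLocalOfOrder k g := by
  obtain ⟨F, hF, rfl⟩ := hg
  let extend (q : ℝ × (Fin k → Val m)) : ℝ × (Fin (k + 1) → Val m) :=
    (q.1, Fin.snoc (α := fun _ => Val m) q.2 0)
  have hextend : ContDiff ℝ ∞ extend := by
    refine contDiff_fst.prodMk (contDiff_pi.2 fun i => ?_)
    induction i using Fin.lastCases with
    | last => simp only [Fin.snoc_last]; exact contDiff_const
    | cast i => simp only [Fin.snoc_castSucc]; fun_prop
  refine ⟨fun q => F (extend q), hF.comp hextend, funext fun p => ?_⟩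
  refine (h p (-p.2 k)).symm.trans (congrArg F ?_)
  refine Prod.ext (add_zero _) (funext fun i => ?_)
  induction i using Fin.lastCases with
  | last => simp [jetProj, jetSingle, extend]
  | cast i => simp [jetProj, jetSingle, extend, Pi.single_eq_of_ne i.2.ne]

theorem IsLocalOfOrder.of_Dx {k l : ℕ} {g : Jet m → W} (hg : IsLocalOfOrder (l + 1) g)
    (hDx : IsLocalOfOrder k (Dx g)) (hkl : k ≤ l + 1) : IsLocalOfOrder l g :=
  hg.of_add_jetSingle fun p v => hg.isLocal.add_eq_of_lineDeriv_eq_zero (fun p => by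
    simpa only [hDx.add_jetSingle hkl, left_eq_add] using Dx_add_jetSingle hg p v) p

theorem IsLocal.isLocalOfOrder_of_Dx {k l : ℕ} {g : Jet m → W} (hg : IsLocal g)
    (hDx : IsLocalOfOrder k (Dx g)) (hkl : k ≤ l + 1) : IsLocalOfOrder l g := by
  obtain ⟨n, hn⟩ := isLocal_iff_exists_isLocalOfOrder.1 hg
  replace hn := hn.mono (Nat.le_add_left n l)
  induction n with
  | zero => exact hn
  | succ n ih => exact ih (hn.of_Dx hDx (by lia))

theorem IsLocal.eq_const_of_Dx_eq_zero {g : Jet m → W} (hg : IsLocal g) (h : Dx g = fun _ => 0)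
    (p : Jet m) : g p = g 0 := by
  have hDx : IsLocalOfOrder 0 (Dx g) := h ▸ ⟨fun _ => 0, contDiff_const, rfl⟩
  obtain ⟨F, hF, rfl⟩ := hg.isLocalOfOrder_of_Dx hDx zero_le_one
  have hline (q : Jet m) : lineDeriv ℝ (fun p => F (jetProj m 0 p)) q p = 0 := by
    have hp : jetProj m 0 p = p.1 • jetProj m 0 (1, fun k => q.2 (k + 1)) :=
      Prod.ext (mul_one _).symm (Subsingleton.elim _ _)
    rw [lineDeriv_comp_jetProj hF, hp, map_smul, ← lineDeriv_comp_jetProj hF]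
    exact (congrArg (p.1 • ·) (congrFun h q)).trans (smul_zero _)
  simpa only [zero_add] using hg.add_eq_of_lineDeriv_eq_zero hline 0

theorem eq_of_Dx_eq {f g : Jet m → W} (hf : IsLocal f) (hg : IsLocal g) (h : Dx f = Dx g)
    (h0 : f 0 = g 0) : f = g := by
  funext p
  have hsub := (hf.sub hg).eq_const_of_Dx_eq_zero (by simp only [Dx_sub hf hg, h, sub_self]) p
  rwa [h0, sub_self, sub_eq_zero] at hsub

theorem DxInv_eq {f g : Jet m → W} (hg : IsLocal g) (h : Dx g = f) (h0 : g 0 = 0) :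
    DxInv f = g := by
  have hex : ∃ g : Jet m → W, IsLocal g ∧ Dx g = f ∧ g 0 = 0 := ⟨g, hg, h, h0⟩
  rw [DxInv, dif_pos hex]
  obtain ⟨hlocal, hDx, hzero⟩ := hex.choose_spec
  exact eq_of_Dx_eq hlocal hg (hDx.trans h.symm) (hzero.trans h0.symm)

theorem IsTotalDeriv.DxInv_spec {f : Jet m → W} (hf : IsTotalDeriv f) :
    IsLocal (DxInv f) ∧ Dx (DxInv f) = f ∧ DxInv f 0 = 0 := by
  obtain ⟨g, hg, rfl⟩ := hf
  have hlocal : IsLocal (fun p => g p - g 0) := hg.sub (isLocal_const (g 0))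
  have hDx : Dx (fun p => g p - g 0) = Dx g := by
    rw [Dx_sub hg (isLocal_const _), Dx_const]
    exact funext fun p => sub_zero _
  rw [DxInv_eq hlocal hDx (sub_self _)]
  exact ⟨hlocal, hDx, sub_self _⟩

theorem isTotalDeriv_zero : IsTotalDeriv (fun _ : Jet m => (0 : W)) :=
  ⟨fun _ => 0, isLocal_const 0, Dx_const 0⟩

theorem IsTotalDeriv.add {f g : Jet m → W} (hf : IsTotalDeriv f) (hg : IsTotalDeriv g) :
    IsTotalDeriv (fun p => f p + g p) := by
  obtain ⟨a, ha, rfl⟩ := hf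
  obtain ⟨b, hb, rfl⟩ := hg
  exact ⟨_, ha.add hb, Dx_add ha hb⟩

theorem IsTotalDeriv.const_smul (c : ℝ) {f : Jet m → W} (hf : IsTotalDeriv f) :
    IsTotalDeriv (fun p => c • f p) := by
  obtain ⟨a, ha, rfl⟩ := hf
  exact ⟨_, ha.const_smul c, Dx_const_smul c ha⟩

theorem DxInv_const_smul (c : ℝ) {f : Jet m → W} (hf : IsTotalDeriv f) :
    DxInv (fun p => c • f p) = fun p => c • DxInv f p := by
  obtain ⟨hlocal, hDx, hzero⟩ := hf.DxInv_spec
  refine DxInv_eq (hlocal.const_smul c) ?_ (by rw [hzero, smul_zero])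
  rw [Dx_const_smul c hlocal, hDx]

theorem EqFunctional.refl (f : Jet m → ℝ) : EqFunctional f f := by
  simp only [EqFunctional, sub_self]
  exact isTotalDeriv_zero

theorem EqFunctional.symm {f g : Jet m → ℝ} (h : EqFunctional f g) : EqFunctional g f := by
  simpa [EqFunctional] using IsTotalDeriv.const_smul (-1) h

theorem EqFunctional.trans {f g h : Jet m → ℝ} (hfg : EqFunctional f g) (hgh : EqFunctional g h) :
    EqFunctional f h := by
  simpa [EqFunctional] using IsTotalDeriv.add hfg hgh

theorem EqFunctional.add {f g f' g' : Jet m → ℝ} (h : EqFunctional f g)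
    (h' : EqFunctional f' g') : EqFunctional (fun p => f p + f' p) (fun p => g p + g' p) := by
  simpa only [EqFunctional, add_sub_add_comm] using IsTotalDeriv.add h h'

theorem EqFunctional.const_mul (c : ℝ) {f g : Jet m → ℝ} (h : EqFunctional f g) :
    EqFunctional (fun p => c * f p) (fun p => c * g p) := by
  simpa only [EqFunctional, ← mul_sub, smul_eq_mul] using IsTotalDeriv.const_smul c h

theorem EqFunctional.neg {f g : Jet m → ℝ} (h : EqFunctional f g) :
    EqFunctional (fun p => -f p) (fun p => -g p) := by
  simpa using h.const_mul (-1)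

theorem EqFunctional.sum {ι : Type} (s : Finset ι) {f g : ι → Jet m → ℝ}
    (h : ∀ i, EqFunctional (f i) (g i)) :
    EqFunctional (fun p => ∑ i ∈ s, f i p) (fun p => ∑ i ∈ s, g i p) := by
  classical
  induction s using Finset.induction_on with
  | empty => simpa using EqFunctional.refl (m := m) (fun _ => 0)
  | insert a s ha ih => simpa [Finset.sum_insert ha] using (h a).add ih

/-- The highest derivative enters `Dx g` only through the chain rule, hence affinely. -/
theorem IsTotalDeriv.add_jetSingle_two_smul {f : Jet m → ℝ} (hf : IsTotalDeriv f) {N : ℕ}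
    (hN : IsLocalOfOrder (N + 2) f) (p : Jet m) (v : Val m) :
    f (p + jetSingle (N + 1) (v + v)) - f p = 2 * (f (p + jetSingle (N + 1) v) - f p) := by
  obtain ⟨g, hg, rfl⟩ := hf
  have hgN := hg.isLocalOfOrder_of_Dx hN le_rfl
  rw [Dx_add_jetSingle hgN, Dx_add_jetSingle hgN, jetSingle_add]
  obtain ⟨F, hF, rfl⟩ := hgN
  rw [lineDeriv_comp_jetProj hF, lineDeriv_comp_jetProj hF, map_add, map_add]
  ring

theorem IsLocalOfOrder.eq_zero_of_isTotalDeriv_mul_sq {N : ℕ} {f : Jet m → ℝ}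
    (hf : IsLocalOfOrder (N + 1) f) {L : Val m →L[ℝ] ℝ} {v : Val m} (hL : L v ≠ 0)
    (h : IsTotalDeriv (fun p => f p * L (p.2 (N + 1)) ^ 2)) : f = fun _ => 0 := by
  have horder : IsLocalOfOrder (N + 2) (fun p => f p * L (p.2 (N + 1)) ^ 2) :=
    ((hf.mono (N + 1).le_succ).prodMk (isLocalOfOrder_coord (N + 1))).comp
      (G := fun x : ℝ × Val m => x.1 * L x.2 ^ 2) (by fun_prop)
  funext p
  have haffine := h.add_jetSingle_two_smul horder p v
  have hcoord (w : Val m) : (p + jetSingle (N + 1) w).2 (N + 1) = p.2 (N + 1) + w := by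
    simp [jetSingle]
  simp only [hf.add_jetSingle le_rfl, hcoord, map_add] at haffine
  refine (mul_eq_zero.1 ?_).resolve_left (pow_ne_zero 2 hL)
  linear_combination haffine / 2

end Kernel

/-! ### The pairing and variational derivatives -/

section Variational

variable {m : ℕ}

theorem rePair_eq (a b : Val m) : rePair a b =
    inner ℝ (a.1 : ℍ[ℝ]) (b.1 : ℍ[ℝ]) + ∑ i, inner ℝ (a.2 i) (b.2 i) := by
  simp only [rePair, herm, Quaternion.inner_def, Quaternion.re_add]
  congr 1
  exact map_sum (QuaternionAlgebra.reₗ (R := ℝ) _ _ _) _ _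

theorem rePair_comm (a b : Val m) : rePair a b = rePair b a := by
  simp only [rePair_eq, real_inner_comm]

theorem rePair_self_eq_zero {a : Val m} (h : rePair a a = 0) : a = 0 := by
  rw [rePair_eq, add_eq_zero_iff_of_nonneg real_inner_self_nonneg
    (Finset.sum_nonneg fun _ _ => real_inner_self_nonneg),
    Finset.sum_eq_zero_iff_of_nonneg fun _ _ => real_inner_self_nonneg] at h
  refine Prod.ext (Subtype.ext (inner_self_eq_zero.1 h.1)) (funext fun i => ?_)
  exact inner_self_eq_zero.1 (h.2 i (Finset.mem_univ i))

/-- `rePair` as a bilinear form. -/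
def rePairₗ (m : ℕ) : LinearMap.BilinForm ℝ (Val m) :=
  LinearMap.mk₂ ℝ rePair
    (fun a b c => by simp [rePair_eq, inner_add_left, Finset.sum_add_distrib]; ring)
    (fun r a b => by simp [rePair_eq, inner_smul_left, mul_add, Finset.mul_sum])
    (fun a b c => by simp [rePair_eq, inner_add_right, Finset.sum_add_distrib]; ring)
    (fun r a b => by simp [rePair_eq, inner_smul_right, mul_add, Finset.mul_sum])

/-- `rePair` as a continuous bilinear map. -/
def rePairL (m : ℕ) : Val m →L[ℝ] Val m →L[ℝ] ℝ := (rePairₗ m).toContinuousBilinearMap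

theorem rePairL_apply (a b : Val m) : rePairL m a b = rePair a b := rfl

protected theorem IsLocal.pairing {f g : Jet m → Val m} (hf : IsLocal f) (hg : IsLocal g) :
    IsLocal (pairing f g) := hf.bilin (rePairL m) hg

theorem Dx_pairing {f g : Jet m → Val m} (hf : IsLocal f) (hg : IsLocal g) :
    Dx (pairing f g) = fun p => pairing (Dx f) g p + pairing f (Dx g) p :=
  Dx_bilin (rePairL m) hf hg

theorem pairing_comm (f g : Jet m → Val m) : pairing f g = pairing g f :=
  funext fun _ => rePair_comm _ _

theorem pairing_Dx_left {f g : Jet m → Val m} (hf : IsLocal f) (hg : IsLocal g) :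
    EqFunctional (pairing (Dx f) g) (pairing f (Dx (fun p => -g p))) := by
  refine ⟨pairing f g, hf.pairing hg, ?_⟩
  rw [Dx_pairing hf hg, Dx_neg hg]
  funext p
  rw [pairing, pairing, pairing, ← rePairL_apply (f p) (-Dx g p), map_neg, rePairL_apply,
    sub_neg_eq_add]

theorem exists_pairing_iterate_Dx {g : Jet m → Val m} (hg : IsLocal g) (k : ℕ) :
    ∃ w, IsLocal w ∧ ∀ X : Jet m → Val m, IsLocal X →
      EqFunctional (pairing (Dx^[k] X) g) (pairing X w) := by
  induction k generalizing g with
  | zero => exact ⟨g, hg, fun X _ => EqFunctional.refl _⟩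
  | succ k ih =>
    obtain ⟨w, hw, h⟩ := ih hg.neg.Dx
    refine ⟨w, hw, fun X hX => EqFunctional.trans ?_ (h X hX)⟩
    rw [Function.iterate_succ_apply']
    exact pairing_Dx_left (hX.iterate_Dx k) hg

theorem rePairₗ_nondegenerate (m : ℕ) : (rePairₗ m).Nondegenerate :=
  ⟨fun x hx => rePair_self_eq_zero (hx x), fun x hx => rePair_self_eq_zero (hx x)⟩

/-- The Riesz representation of linear functionals on `Val m` with respect to `rePair`. -/
def riesz (m : ℕ) : (Val m →L[ℝ] ℝ) →L[ℝ] Val m :=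
  LinearMap.toContinuousLinearMap (E := Val m →L[ℝ] ℝ)
    (((rePairₗ m).toDual (rePairₗ_nondegenerate m)).symm.toLinearMap ∘ₗ
      (ContinuousLinearMap.coeLM ℝ : (Val m →L[ℝ] ℝ) →ₗ[ℝ] Val m →ₗ[ℝ] ℝ))

theorem rePair_riesz (φ : Val m →L[ℝ] ℝ) (v : Val m) : rePair v (riesz m φ) = φ v := by
  rw [rePair_comm]
  exact LinearMap.BilinForm.apply_toDual_symm_apply (hB := rePairₗ_nondegenerate m)
    (φ : Module.Dual ℝ (Val m)) v

theorem IsLocal.exists_prolong_eq_sum_pairing {G : Jet m → ℝ} (hG : IsLocal G) :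
    ∃ (k : ℕ) (g : Fin k → Jet m → Val m), (∀ i, IsLocal (g i)) ∧
      ∀ X, prolong X G = fun p => ∑ i : Fin k, pairing (Dx^[i] X) (g i) p := by
  obtain ⟨k, F, hF, rfl⟩ := isLocal_iff_exists_isLocalOfOrder.1 hG
  let ι (i : Fin k) : Val m →L[ℝ] ℝ × (Fin k → Val m) :=
    (ContinuousLinearMap.inr ℝ ℝ _).comp (ContinuousLinearMap.single ℝ (fun _ : Fin k => Val m) i)
  have hfderiv : IsLocal (fun p : Jet m => fderiv ℝ F (jetProj m k p)) :=
    (isLocal_jetProj k).comp (hF.fderiv_right (m := ∞) (by simp))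
  refine ⟨k, fun i p => riesz m ((fderiv ℝ F (jetProj m k p)).comp (ι i)), fun i =>
    hfderiv.comp (G := fun φ => riesz m (φ.comp (ι i)))
      ((riesz m).contDiff.comp (contDiff_id.clm_comp contDiff_const)), fun X => funext fun p => ?_⟩
  have hX : jetProj m k ((0, fun j => Dx^[j] X p) : Jet m) = ∑ i : Fin k, ι i (Dx^[i] X p) := by
    simp only [ι, ContinuousLinearMap.comp_apply, ← map_sum]
    refine Prod.ext (by simp [jetProj, Prod.fst_sum]) (funext fun j => ?_)
    simp [jetProj, Prod.snd_sum, Finset.sum_apply, Pi.single_apply]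
  rw [prolong, lineDeriv_comp_jetProj hF, hX, map_sum]
  simp only [pairing, rePair_riesz, ContinuousLinearMap.comp_apply]

theorem exists_isVarDeriv {G : Jet m → ℝ} (hG : IsLocal G) : ∃ w, IsVarDeriv G w := by
  obtain ⟨k, g, hg, hprolong⟩ := hG.exists_prolong_eq_sum_pairing
  choose w hw hpairing using fun i : Fin k => exists_pairing_iterate_Dx (hg i) i
  refine ⟨fun p => ∑ i, w i p,
    (isLocal_pi hw).comp (G := fun v : Fin k → Val m => ∑ i, v i) (by fun_prop), fun X hX => ?_⟩
  have hsum : pairing X (fun p => ∑ i, w i p) = fun p => ∑ i, pairing X (w i) p :=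
    funext fun p => map_sum (rePairL m (X p)) _ _
  rw [hprolong, hsum]
  exact EqFunctional.sum _ fun i => hpairing i X hX

/-- Test against `X = ⟨c, ∂ᴺu⟩² z` with `N` beyond the order of `z`: the resulting density is
quadratic in its highest derivative, hence no total derivative unless `|z|² = 0`. -/
theorem eq_zero_of_forall_isTotalDeriv_pairing {z : Jet m → Val m} (hz : IsLocal z)
    (h : ∀ X : Jet m → Val m, IsLocal X → IsTotalDeriv (pairing X z)) : z = 0 := by
  obtain ⟨N, hN⟩ := isLocal_iff_exists_isLocalOfOrder.1 hz
  have hnormSq : IsLocalOfOrder (N + 1) (fun p => rePair (z p) (z p)) :=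
    (hN.mono N.le_succ).comp (G := fun v => rePairL m v v) (by fun_prop)
  let c : Val m := (⟨⟨0, 1, 0, 0⟩, rfl⟩, 0)
  have hc : rePairL m c c ≠ 0 := fun h0 => by
    simpa [c] using congrArg (fun a : Val m => (a.1 : ℍ[ℝ]).imI) (rePair_self_eq_zero h0)
  have hX : IsLocal (fun p : Jet m => rePairL m c (p.2 (N + 1)) ^ 2 • z p) :=
    IsLocal.smul ((isLocal_coord (N + 1)).comp (G := fun v => rePairL m c v ^ 2) (by fun_prop)) hz
  have hXz : pairing (fun p => rePairL m c (p.2 (N + 1)) ^ 2 • z p) z =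
      fun p => rePair (z p) (z p) * rePairL m c (p.2 (N + 1)) ^ 2 := by
    funext p
    rw [pairing, ← rePairL_apply, map_smul, smul_apply, rePairL_apply (z p),
      smul_eq_mul, mul_comm]
  funext p
  exact rePair_self_eq_zero (congrFun (hnormSq.eq_zero_of_isTotalDeriv_mul_sq hc
    (hXz ▸ h _ hX)) p)

theorem IsVarDeriv.unique {G : Jet m → ℝ} {w w' : Jet m → Val m} (hw : IsVarDeriv G w)
    (hw' : IsVarDeriv G w') : w = w' := by
  have hzero := eq_zero_of_forall_isTotalDeriv_pairing (hw.1.sub hw'.1) fun X hX => by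
    have hsub : pairing X (fun p => w p - w' p) = fun p => pairing X w p - pairing X w' p :=
      funext fun p => map_sub (rePairL m (X p)) _ _
    rw [hsub]
    exact (hw.2 X hX).symm.trans (hw'.2 X hX)
  exact funext fun p => sub_eq_zero.1 (congrFun hzero p)

theorem isVarDeriv_varDeriv {G : Jet m → ℝ} (hG : IsLocal G) : IsVarDeriv G (varDeriv G) := by
  rw [varDeriv, dif_pos (exists_isVarDeriv hG)]
  exact (exists_isVarDeriv hG).choose_spec

theorem IsVarDeriv.varDeriv_eq {G : Jet m → ℝ} {w : Jet m → Val m} (hw : IsVarDeriv G w) :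
    varDeriv G = w := by
  have h : ∃ w, IsVarDeriv G w := ⟨w, hw⟩
  rw [varDeriv, dif_pos h]
  exact h.choose_spec.unique hw

end Variational

/-! ### The symmetric Lie algebra in matrix form -/

theorem IsDerivation.mapMatrix {n R : Type*} [Fintype n] [DecidableEq n] [Ring R] {D : R →+ R}
    (hD : IsDerivation D) : IsDerivation (A := Matrix n n R) D.mapMatrix := by
  intro X Y
  ext i j
  simp only [AddMonoidHom.mapMatrix_apply, Matrix.map_apply, Matrix.mul_apply, Matrix.add_apply,
    map_sum, hD.map_mul, Finset.sum_add_distrib]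

section Shapes

/-- The index set of the matrices: two distinguished indices `none` and `some none`, and `m`
further ones. -/
abbrev Idx (m : ℕ) : Type := Option (Option (Fin m))

variable {m : ℕ} {R : Type*}

theorem matrix_ext_idx {X Y : Matrix (Idx m) (Idx m) R}
    (h₀₀ : X none none = Y none none)
    (h₀₁ : X none (some none) = Y none (some none))
    (h₁₀ : X (some none) none = Y (some none) none)
    (h₁₁ : X (some none) (some none) = Y (some none) (some none))
    (h₀ : ∀ j, X none (some (some j)) = Y none (some (some j)))
    (h₁ : ∀ j, X (some none) (some (some j)) = Y (some none) (some (some j)))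
    (h₀' : ∀ i, X (some (some i)) none = Y (some (some i)) none)
    (h₁' : ∀ i, X (some (some i)) (some none) = Y (some (some i)) (some none))
    (h : ∀ i j, X (some (some i)) (some (some j)) = Y (some (some i)) (some (some j))) :
    X = Y := by
  ext i j
  rcases i with _ | _ | i <;> rcases j with _ | _ | j <;> simp_all

variable [Ring R]

/-- The multiple `ρ (E₀₁ + E₁₀)` of the Cartan element. -/
def rhoMat (ρ : R) : Matrix (Idx m) (Idx m) R
  | none, some none => ρ
  | some none, none => ρ
  | _, _ => 0

/-- The Cartan element `E₀₁ + E₁₀`. -/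
def eMat : Matrix (Idx m) (Idx m) R := rhoMat 1

/-- The block diagonal matrices `diag(q, q, S)`, which commute with the Cartan element. -/
def parMat (q : R) (S : Fin m → Fin m → R) : Matrix (Idx m) (Idx m) R
  | none, none => q
  | some none, some none => q
  | some (some i), some (some j) => S i j
  | _, _ => 0

/-- The signature matrix `diag(-1, 1, …, 1)`. -/
def sigMat : Matrix (Idx m) (Idx m) R := Matrix.diagonal fun i => i.elim (-1) fun _ => 1

theorem sigMat_mul_self : (sigMat : Matrix (Idx m) (Idx m) R) * sigMat = 1 := by
  rw [sigMat, Matrix.diagonal_mul_diagonal, ← Matrix.diagonal_one]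
  congr 1
  funext i
  cases i <;> simp

/-- The Cartan involution of the symmetric Lie algebra: conjugation by the signature matrix. -/
def sigConj : Matrix (Idx m) (Idx m) R →+* Matrix (Idx m) (Idx m) R :=
  MulSemiringAction.toRingHom (ConjAct (Matrix (Idx m) (Idx m) R)ˣ) (Matrix (Idx m) (Idx m) R)
    (ConjAct.toConjAct ⟨sigMat, sigMat, sigMat_mul_self, sigMat_mul_self⟩)

theorem sigConj_apply (X : Matrix (Idx m) (Idx m) R) : sigConj X = sigMat * X * sigMat := rfl

theorem apply_eq_zero_of_sigConj_eq [IsAddTorsionFree R] {X : Matrix (Idx m) (Idx m) R}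
    (hX : sigConj X = X) (i : Option (Fin m)) : X none (some i) = 0 ∧ X (some i) none = 0 := by
  have hentry (j k) : (sigMat * X * sigMat : Matrix (Idx m) (Idx m) R) j k = X j k :=
    congrFun (congrFun hX j) k
  exact ⟨neg_eq_self.1 (by simpa [sigMat] using hentry none (some i)),
    neg_eq_self.1 (by simpa [sigMat] using hentry (some i) none)⟩

theorem apply_eq_zero_of_sigConj_eq_neg [IsAddTorsionFree R] {X : Matrix (Idx m) (Idx m) R}
    (hX : sigConj X = -X) : X none none = 0 ∧ ∀ i j, X (some i) (some j) = 0 := by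
  have hentry (j k) : -X j k = (sigMat * X * sigMat : Matrix (Idx m) (Idx m) R) j k :=
    (congrFun (congrFun hX j) k).symm
  exact ⟨neg_eq_self.1 (by simpa [sigMat] using hentry none none), fun i j =>
    neg_eq_self.1 (by simpa [sigMat] using hentry (some i) (some j))⟩

theorem eMat_pow_three : (eMat : Matrix (Idx m) (Idx m) R) ^ 3 = eMat := by
  rw [pow_three]
  apply matrix_ext_idx <;> simp [Matrix.mul_apply, Fintype.sum_option, eMat, rhoMat]

theorem sigConj_eMat : sigConj (eMat : Matrix (Idx m) (Idx m) R) = -eMat := by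
  rw [sigConj_apply]
  apply matrix_ext_idx <;> simp [sigMat, eMat, rhoMat]

theorem eMat_lie_rhoMat (ρ : R) :
    ⁅(eMat : Matrix (Idx m) (Idx m) R), (rhoMat ρ : Matrix (Idx m) (Idx m) R)⁆ = 0 := by
  rw [Ring.lie_def]
  apply matrix_ext_idx <;> simp [Matrix.mul_apply, Fintype.sum_option, eMat, rhoMat]

variable [StarRing R]

/-- The embedding of `𝒬 ⊕ ℍ ^ m` into the even part of the Lie algebra. -/
def kMat (a : R) (v : Fin m → R) : Matrix (Idx m) (Idx m) R
  | none, none => -a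
  | some none, some none => a
  | some none, some (some j) => v j
  | some (some i), some none => -star (v i)
  | _, _ => 0

/-- The embedding of `𝒬 ⊕ ℍ ^ m` into the odd part of the Lie algebra. -/
def mMat (a : R) (v : Fin m → R) : Matrix (Idx m) (Idx m) R
  | none, some none => a
  | some none, none => -a
  | none, some (some j) => v j
  | some (some i), none => star (v i)
  | _, _ => 0

theorem sigConj_kMat (a : R) (v : Fin m → R) : sigConj (kMat a v) = kMat a v := by
  rw [sigConj_apply]
  apply matrix_ext_idx <;> simp [sigMat, kMat]

theorem star_eMat : star (eMat : Matrix (Idx m) (Idx m) R) = eMat := by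
  rw [Matrix.star_eq_conjTranspose]
  apply matrix_ext_idx <;> simp [eMat, rhoMat]

theorem star_kMat {a : R} (ha : star a = -a) (v : Fin m → R) : star (kMat a v) = -kMat a v := by
  rw [Matrix.star_eq_conjTranspose]
  apply matrix_ext_idx <;> simp [kMat, ha]

theorem eMat_lie_kMat (a : R) (v : Fin m → R) :
    ⁅(eMat : Matrix (Idx m) (Idx m) R), kMat a v⁆ = mMat (a + a) v := by
  rw [Ring.lie_def]
  apply matrix_ext_idx <;>
    simp [Matrix.mul_apply, Fintype.sum_option, eMat, rhoMat, kMat, mMat, sub_eq_add_neg]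

theorem eMat_lie_mMat (a : R) (v : Fin m → R) :
    ⁅(eMat : Matrix (Idx m) (Idx m) R), mMat a v⁆ = kMat (a + a) v := by
  rw [Ring.lie_def]
  apply matrix_ext_idx <;>
    simp [Matrix.mul_apply, Fintype.sum_option, eMat, rhoMat, kMat, mMat, sub_eq_add_neg]

theorem kMat_injective {a b : R} {v w : Fin m → R} (h : kMat a v = kMat b w) : a = b ∧ v = w :=
  ⟨congrFun (congrFun h (some none)) (some none),
    funext fun j => congrFun (congrFun h (some none)) (some (some j))⟩

theorem eq_kMat_add_parMat [IsAddTorsionFree R] {X : Matrix (Idx m) (Idx m) R} (hσ : sigConj X = X)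
    (hstar : star X = -X) {a : R} (ha : star a = -a) {v : Fin m → R}
    (he : ⁅(eMat : Matrix (Idx m) (Idx m) R), X⁆ = mMat (a + a) v) :
    ∃ q S, star q = -q ∧ (∀ i j, star (S i j) = -S j i) ∧ X = kMat a v + parMat q S := by
  have hstar (i j) : star (X j i) = -X i j := congrFun (congrFun hstar i) j
  have hlie (i j) : (eMat * X - X * eMat : Matrix (Idx m) (Idx m) R) i j = mMat (a + a) v i j :=
    congrFun (congrFun he i) j
  have hdiag : X (some none) (some none) - X none none = a + a := by
    simpa [Matrix.mul_apply, Fintype.sum_option, eMat, rhoMat, mMat] using hlie none (some none)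
  have hrow (j) : X (some none) (some (some j)) = v j := by
    simpa [Matrix.mul_apply, Fintype.sum_option, eMat, rhoMat, mMat] using
      hlie none (some (some j))
  refine ⟨X (some none) (some none) - a, fun i j => X (some (some i)) (some (some j)),
    by rw [star_sub, hstar, ha]; abel, fun i j => hstar _ _, ?_⟩
  apply matrix_ext_idx
  case h₀₀ =>
    simp only [Matrix.add_apply, kMat, parMat, eq_add_of_sub_eq hdiag]
    abel
  all_goals simp [kMat, parMat, apply_eq_zero_of_sigConj_eq hσ, ← hrow, hstar]

theorem eq_mMat_add_rhoMat [IsAddTorsionFree R] {X : Matrix (Idx m) (Idx m) R}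
    (hσ : sigConj X = -X) (hstar : star X = X) {a : R} (ha : star a = -a) {v : Fin m → R}
    (he : ⁅(eMat : Matrix (Idx m) (Idx m) R), X⁆ = kMat (a + a) v) :
    ∃ ρ, star ρ = ρ ∧ X = mMat a v + rhoMat ρ := by
  have hstar (i j) : star (X j i) = X i j := congrFun (congrFun hstar i) j
  have hlie (i j) : (eMat * X - X * eMat : Matrix (Idx m) (Idx m) R) i j = kMat (a + a) v i j :=
    congrFun (congrFun he i) j
  have hdiag : X none (some none) - X (some none) none = a + a := by
    simpa [Matrix.mul_apply, Fintype.sum_option, eMat, rhoMat, kMat] using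
      hlie (some none) (some none)
  have hrow (j) : X none (some (some j)) = v j := by
    simpa [Matrix.mul_apply, Fintype.sum_option, eMat, rhoMat, kMat] using
      hlie (some none) (some (some j))
  refine ⟨X none (some none) - a, ?_, ?_⟩
  · rw [star_sub, hstar, ha, eq_add_of_sub_eq hdiag]
    abel
  apply matrix_ext_idx
  case h₁₀ =>
    simp only [Matrix.add_apply, mMat, rhoMat, eq_add_of_sub_eq hdiag]
    abel
  all_goals simp [mMat, rhoMat, apply_eq_zero_of_sigConj_eq_neg hσ, ← hrow, hstar]

variable [Algebra ℝ R] {D : R →+ R} {u : R} {U Z : Fin m → R}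

/-- The covariant derivative of an even element with compensating block `diag(q, q, S)` is the
first Hamiltonian operator, `q` and `S` being nonlocal terms. -/
theorem mapMatrix_sub_lie_kMat (hD : ∀ a, D (star a) = star (D a)) {w q : R}
    {S : Fin m → Fin m → R} (hu : star u = -u) (hw : star w = -w) (hq : star q = -q)
    (hS : ∀ i j, star (S i j) = -S j i)
    (hDq : D q = u * w - w * u - (1 / 2 : ℝ) • (∑ i, U i * star (Z i) - ∑ i, Z i * star (U i)))
    (hDS : ∀ i j, D (S i j) = -(star (U i) * Z j - star (Z i) * U j)) :
    D.mapMatrix (kMat w Z + parMat q S) - ⁅kMat u U, kMat w Z + parMat q S⁆ =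
    kMat (D w - (u * q - q * u) + (1 / 2 : ℝ) • (∑ i, U i * star (Z i) - ∑ i, Z i * star (U i)))
      (fun j => D (Z j) + q * U j - ∑ i, U i * S i j + w * U j - u * Z j) := by
  rw [Ring.lie_def]
  apply matrix_ext_idx
  all_goals simp only [AddMonoidHom.mapMatrix_apply, Matrix.map_apply, Matrix.mul_apply,
    Matrix.add_apply, Matrix.sub_apply, Fintype.sum_option, kMat, parMat, map_add, map_neg,
    map_zero, hDq, hDS, add_zero, zero_add, mul_zero, zero_mul, Finset.sum_const_zero, mul_add,
    add_mul, mul_neg, neg_mul, Finset.sum_neg_distrib, neg_zero, sub_self, implies_true]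
  · module
  · module
  · intro j
    abel
  · intro j
    simp only [star_add, star_sub, star_mul, star_sum, hS, hu, hw, hq, hD, neg_mul, mul_neg,
      Finset.sum_neg_distrib]
    abel
  · intro i j
    abel

/-- The covariant derivative of an odd element with compensating multiple of the Cartan element is
the symplectic operator, `ρ` being a nonlocal term. -/
theorem mapMatrix_sub_lie_mMat (hD : ∀ a, D (star a) = star (D a)) {s ρ : R}
    (hu : star u = -u) (hs : star s = -s) (hρ : star ρ = ρ) (hρu : Commute ρ u)
    (hDρ : D ρ = -(u * s + s * u) +
      (1 / 2 : ℝ) • (∑ i, U i * star (Z i) + ∑ i, Z i * star (U i))) :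
    D.mapMatrix (mMat s Z + rhoMat ρ) - ⁅kMat u U, mMat s Z + rhoMat ρ⁆ =
    mMat (D s + (1 / 2 : ℝ) • (∑ i, U i * star (Z i) - ∑ i, Z i * star (U i)) + (ρ * u + ρ * u))
      (fun j => D (Z j) + s * U j + u * Z j + ρ * U j) := by
  rw [Ring.lie_def]
  apply matrix_ext_idx
  all_goals simp only [AddMonoidHom.mapMatrix_apply, Matrix.map_apply, Matrix.mul_apply,
    Matrix.add_apply, Matrix.sub_apply, Fintype.sum_option, kMat, mMat, rhoMat, map_add, map_neg,
    map_zero, hDρ, add_zero, zero_add, mul_zero, zero_mul, Finset.sum_const_zero, mul_add,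
    add_mul, mul_neg, neg_mul, Finset.sum_neg_distrib, neg_zero, sub_self, implies_true,
    hρu.eq]
  · module
  · module
  · intro j
    abel
  · intro j
    simp only [star_add, star_mul, hρ, hu, hs, hD, mul_neg]
    abel

end Shapes

/-! ### Matrices of quaternion-valued functions on the jet space -/

theorem star_coe_imQ (a : ImQ) : star (a : ℍ[ℝ]) = -a := Quaternion.star_eq_neg.2 a.2

theorem re_mul_comm (a b : ℍ[ℝ]) : (a * b).re = (b * a).re := by
  simp only [Quaternion.re_mul]
  ring

/-- Quaternion conjugation as a continuous linear map. -/
def starCLM : ℍ[ℝ] →L[ℝ] ℍ[ℝ] :=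
  haveI : StarModule ℝ ℍ[ℝ] := ⟨fun r a => Quaternion.star_smul r a⟩
  (starL' ℝ : ℍ[ℝ] ≃L[ℝ] ℍ[ℝ])

/-- The real part of a quaternion as a continuous linear map. -/
def reCLM : ℍ[ℝ] →L[ℝ] ℝ := ⟨QuaternionAlgebra.reₗ (R := ℝ) (-1) 0 (-1), Quaternion.continuous_re⟩

theorem re_sum {ι : Type*} (s : Finset ι) (f : ι → ℍ[ℝ]) :
    (∑ i ∈ s, f i).re = ∑ i ∈ s, (f i).re :=
  map_sum reCLM f s

section LocalRing

variable {m : ℕ}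

/-- The algebra of quaternion-valued functions on the jet space. -/
def localRing (m : ℕ) : Subalgebra ℝ (Jet m → ℍ[ℝ]) where
  carrier := {f | IsLocal f}
  mul_mem' hf hg := hf.bilin (ContinuousLinearMap.mul ℝ ℍ[ℝ]) hg
  add_mem' hf hg := hf.add hg
  algebraMap_mem' r := isLocal_const (algebraMap ℝ ℍ[ℝ] r)

instance : IsAddTorsionFree (localRing m) := .of_isTorsionFree ℝ _

instance : StarRing (localRing m) where
  star f := ⟨fun p => star (f.1 p), IsLocal.clm starCLM f.2⟩
  star_involutive f := Subtype.ext (star_star f.1)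
  star_mul f g := Subtype.ext (star_mul f.1 g.1)
  star_add f g := Subtype.ext (star_add f.1 g.1)

theorem localRing_ext {f g : localRing m} (h : ∀ p, f.1 p = g.1 p) : f = g :=
  Subtype.ext (funext h)

@[simp] theorem star_localRing_apply (f : localRing m) (p : Jet m) :
    (star f).1 p = star (f.1 p) := rfl

/-- Differentiation of quaternion-valued functions along a vector field. -/
def derivAlongHom {v : Jet m → Jet m} (hv : IsLocalField v) : localRing m →+ localRing m :=
  .mk' (fun f => ⟨derivAlong v f.1, hv.isLocal_derivAlong f.2⟩) fun f g =>
    localRing_ext fun p => IsLocal.lineDeriv_add f.2 g.2 p (v p)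

theorem isDerivation_derivAlongHom {v : Jet m → Jet m} (hv : IsLocalField v) :
    IsDerivation (derivAlongHom hv) := fun f g => localRing_ext fun p =>
  IsLocal.lineDeriv_bilin (ContinuousLinearMap.mul ℝ ℍ[ℝ]) f.2 g.2 p (v p)

theorem derivAlongHom_star {v : Jet m → Jet m} (hv : IsLocalField v) (f : localRing m) :
    derivAlongHom hv (star f) = star (derivAlongHom hv f) :=
  localRing_ext fun p => IsLocal.lineDeriv_clm starCLM f.2 p (v p)

/-- The total derivative of quaternion-valued functions. -/
def totalHom (m : ℕ) : localRing m →+ localRing m := derivAlongHom isLocalField_totalField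

theorem totalHom_apply (f : localRing m) (p : Jet m) : (totalHom m f).1 p = Dx f.1 p := rfl

/-- The action of an evolutionary vector field on quaternion-valued functions. -/
def prolongHom {X : Jet m → Val m} (hX : IsLocal X) : localRing m →+ localRing m :=
  derivAlongHom (isLocalField_prolongField hX)

theorem totalHom_prolongHom {X : Jet m → Val m} (hX : IsLocal X) (f : localRing m) :
    totalHom m (prolongHom hX f) = prolongHom hX (totalHom m f) :=
  Subtype.ext (Dx_prolong hX f.2)

/-- The ring of matrices over the quaternion-valued functions on the jet space, in which the Lax
equation is solved. -/
abbrev LMat (m : ℕ) : Type := Matrix (Idx m) (Idx m) (localRing m)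

/-- The first projection of `𝒬 ⊕ ℍ ^ m`, with values in the quaternions. -/
def scalCLM (m : ℕ) : Val m →L[ℝ] ℍ[ℝ] :=
  ImQ.subtypeL.comp (ContinuousLinearMap.fst ℝ ImQ (QVec m))

/-- The projection of `𝒬 ⊕ ℍ ^ m` to a component of the vector. -/
def vecCLM (j : Fin m) : Val m →L[ℝ] ℍ[ℝ] :=
  (ContinuousLinearMap.proj (R := ℝ) j).comp (ContinuousLinearMap.snd ℝ ImQ (QVec m))

/-- The scalar component of a `𝒬 ⊕ ℍ ^ m`-valued function. -/
def scalPart {w : Jet m → Val m} (hw : IsLocal w) : localRing m :=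
  ⟨fun p => (w p).1, hw.clm (scalCLM m)⟩

/-- The vector components of a `𝒬 ⊕ ℍ ^ m`-valued function. -/
def vecPart {w : Jet m → Val m} (hw : IsLocal w) (j : Fin m) : localRing m :=
  ⟨fun p => (w p).2 j, hw.clm (vecCLM j)⟩

@[simp] theorem scalPart_apply {w : Jet m → Val m} (hw : IsLocal w) (p : Jet m) :
    (scalPart hw).1 p = (w p).1 := rfl

@[simp] theorem vecPart_apply {w : Jet m → Val m} (hw : IsLocal w) (j : Fin m) (p : Jet m) :
    (vecPart hw j).1 p = (w p).2 j := rfl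

theorem star_scalPart {w : Jet m → Val m} (hw : IsLocal w) :
    star (scalPart hw) = -scalPart hw :=
  localRing_ext fun p => star_coe_imQ (w p).1

/-- The pair `(w, 𝐰)` as an element of the even part of the Lie algebra. -/
def evenMat {w : Jet m → Val m} (hw : IsLocal w) : LMat m := kMat (scalPart hw) (vecPart hw)

theorem evenMat_congr {w w' : Jet m → Val m} (h : w = w') (hw : IsLocal w) (hw' : IsLocal w') :
    evenMat hw = evenMat hw' := by
  subst h
  rfl

theorem eq_of_evenMat_eq {w w' : Jet m → Val m} {hw : IsLocal w} {hw' : IsLocal w'}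
    (h : evenMat hw = evenMat hw') : w = w' := by
  obtain ⟨hscal, hvec⟩ := kMat_injective h
  funext p
  refine Prod.ext (Subtype.ext (congrFun (congrArg Subtype.val hscal) p)) (funext fun j => ?_)
  exact congrFun (congrArg Subtype.val (congrFun hvec j)) p

theorem mapMatrix_derivAlongHom_evenMat {v : Jet m → Jet m} (hv : IsLocalField v)
    {w : Jet m → Val m} (hw : IsLocal w) :
    (derivAlongHom hv).mapMatrix (evenMat hw) = evenMat (hv.isLocal_derivAlong hw) := by
  have hscal : derivAlongHom hv (scalPart hw) = scalPart (hv.isLocal_derivAlong hw) :=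
    localRing_ext fun p => hw.lineDeriv_clm (scalCLM m) p (v p)
  have hvec (j) : derivAlongHom hv (vecPart hw j) = vecPart (hv.isLocal_derivAlong hw) j :=
    localRing_ext fun p => hw.lineDeriv_clm (vecCLM j) p (v p)
  rw [evenMat, evenMat]
  apply matrix_ext_idx <;> simp [kMat, derivAlongHom_star, hscal, hvec]

theorem mapMatrix_derivAlongHom_eMat {v : Jet m → Jet m} (hv : IsLocalField v) :
    (derivAlongHom hv).mapMatrix (eMat : LMat m) = 0 := by
  have hone : derivAlongHom hv 1 = 0 := by simpa using isDerivation_derivAlongHom hv 1 1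
  apply matrix_ext_idx <;> simp [eMat, rhoMat, hone]

theorem isLocal_uFun (m : ℕ) : IsLocal (uFun m) := isLocal_coord 0

/-- The matrix of the coordinates `(u, 𝐮)`: the potential of the Lax operator. -/
def uMat (m : ℕ) : LMat m := evenMat (isLocal_uFun m)

/-- The total derivative on matrices. -/
def totalMat (m : ℕ) : LMat m →+ LMat m := (totalHom m).mapMatrix

theorem isDerivation_totalMat : IsDerivation (totalMat m) :=
  (isDerivation_derivAlongHom _).mapMatrix

/-- The action of an evolutionary vector field on matrices. -/
def prolongMat {X : Jet m → Val m} (hX : IsLocal X) : LMat m →+ LMat m :=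
  (prolongHom hX).mapMatrix

theorem isDerivation_prolongMat {X : Jet m → Val m} (hX : IsLocal X) :
    IsDerivation (prolongMat hX) :=
  (isDerivation_derivAlongHom _).mapMatrix

theorem totalMat_prolongMat {X : Jet m → Val m} (hX : IsLocal X) (Y : LMat m) :
    totalMat m (prolongMat hX Y) = prolongMat hX (totalMat m Y) :=
  Matrix.ext fun i j => totalHom_prolongHom hX (Y i j)

theorem prolong_uFun (X : Jet m → Val m) : prolong X (uFun m) = X :=
  funext fun p => lineDeriv_coord 0 p _

theorem prolongMat_uMat {X : Jet m → Val m} (hX : IsLocal X) :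
    prolongMat hX (uMat m) = evenMat hX := by
  rw [uMat, prolongMat, prolongHom, mapMatrix_derivAlongHom_evenMat]
  exact evenMat_congr (prolong_uFun X) _ _

/-- The covariant derivative `D - [u, ·]`. -/
def covD (m : ℕ) : LMat m →+ LMat m := totalMat m - innerDer (uMat m)

theorem isDerivation_covD : IsDerivation (covD m) :=
  isDerivation_totalMat.sub (isDerivation_innerDer _)

theorem covD_apply (X : LMat m) : covD m X = totalMat m X - ⁅uMat m, X⁆ := rfl

/-- The real part of the trace. -/
def reTrace (m : ℕ) : LMat m →+ (Jet m → ℝ) :=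
  .mk' (fun X p => (X.trace.1 p).re) fun X Y => by
    funext p
    simp

theorem reTrace_apply (X : LMat m) (p : Jet m) : reTrace m X p = (X.trace.1 p).re := rfl

theorem reTrace_mul_apply (X Y : LMat m) (p : Jet m) :
    reTrace m (X * Y) p = ∑ i, ∑ j, ((X i j).1 p * (Y j i).1 p).re := by
  simp only [reTrace_apply, Matrix.trace, Matrix.diag_apply, Matrix.mul_apply,
    AddSubmonoidClass.coe_finsetSum, Finset.sum_apply, MulMemClass.coe_mul, Pi.mul_apply, re_sum]

theorem reTrace_mul_comm (X Y : LMat m) : reTrace m (X * Y) = reTrace m (Y * X) := by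
  funext p
  rw [reTrace_mul_apply, reTrace_mul_apply, Finset.sum_comm]
  simp only [re_mul_comm]

theorem reTrace_lie (X Y : LMat m) : reTrace m ⁅X, Y⁆ = 0 := by
  rw [Ring.lie_def, map_sub, reTrace_mul_comm, sub_self]

theorem isLocal_reTrace (X : LMat m) : IsLocal (reTrace m X) := IsLocal.clm reCLM X.trace.2

theorem derivAlong_reTrace {v : Jet m → Jet m} (hv : IsLocalField v) (X : LMat m) :
    derivAlong v (reTrace m X) = reTrace m ((derivAlongHom hv).mapMatrix X) := by
  funext p
  rw [reTrace_apply, AddMonoidHom.mapMatrix_apply, ← AddMonoidHom.map_trace]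
  exact IsLocal.lineDeriv_clm reCLM X.trace.2 p (v p)

theorem isTotalDeriv_reTrace (X : LMat m) : IsTotalDeriv (reTrace m (totalMat m X)) :=
  ⟨_, isLocal_reTrace X, derivAlong_reTrace _ X⟩

theorem isTotalDeriv_reTrace_covD (X Y : LMat m) :
    IsTotalDeriv (fun p => reTrace m (covD m X * Y) p + reTrace m (X * covD m Y) p) := by
  have h : reTrace m (covD m X * Y) + reTrace m (X * covD m Y) =
      reTrace m (totalMat m (X * Y)) := by
    rw [← map_add, ← isDerivation_covD.map_mul, covD_apply, map_sub, reTrace_lie, sub_zero]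
  change IsTotalDeriv (reTrace m (covD m X * Y) + reTrace m (X * covD m Y))
  rw [h]
  exact isTotalDeriv_reTrace (X * Y)

theorem reTrace_evenMat_mul_evenMat {w v : Jet m → Val m} (hw : IsLocal w) (hv : IsLocal v)
    (p : Jet m) : reTrace m (evenMat hw * evenMat hv) p = -2 * pairing w v p := by
  have hre (x y : ℍ[ℝ]) : (star x * y).re = (x * star y).re := by
    rw [← Quaternion.re_star, star_mul, star_star, re_mul_comm]
  simp only [reTrace_mul_apply, Fintype.sum_option, evenMat, kMat, pairing, rePair, herm,
    NegMemClass.coe_neg, Pi.neg_apply, scalPart_apply, vecPart_apply, star_localRing_apply,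
    ZeroMemClass.coe_zero, Pi.zero_apply, mul_neg, neg_mul, neg_neg, mul_zero, add_zero, zero_add,
    Quaternion.re_zero, Quaternion.re_neg, Quaternion.re_add, Finset.sum_const_zero,
    Finset.sum_neg_distrib, star_coe_imQ, hre, re_sum]
  ring

theorem reTrace_kMat_mul_parMat (a q : localRing m) (v : Fin m → localRing m)
    (S : Fin m → Fin m → localRing m) : reTrace m (kMat a v * parMat q S) = 0 := by
  funext p
  simp [reTrace_mul_apply, Fintype.sum_option, kMat, parMat]

theorem reTrace_mMat_mul_eMat (a : localRing m) (v : Fin m → localRing m) :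
    reTrace m (mMat a v * eMat) = 0 := by
  funext p
  simp [reTrace_mul_apply, Fintype.sum_option, mMat, eMat, rhoMat]

theorem reTrace_rhoMat_mul_eMat (ρ : localRing m) (p : Jet m) :
    reTrace m (rhoMat ρ * eMat) p = 2 * (ρ.1 p).re := by
  simp [reTrace_mul_apply, Fintype.sum_option, eMat, rhoMat, two_mul]

end LocalRing

/-! ### The operators `ℋ` and `𝒥` in matrix form -/

section Operators

variable {m : ℕ}

theorem coe_Dx_imQ {f : Jet m → ImQ} (hf : IsLocal f) (p : Jet m) :
    ((Dx f p : ImQ) : ℍ[ℝ]) = Dx (fun q => (f q : ℍ[ℝ])) p :=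
  (congrFun (Dx_clm ImQ.subtypeL hf) p).symm

theorem Dx_pi_apply {ι E : Type} [Fintype ι] [NormedAddCommGroup E] [NormedSpace ℝ E]
    {f : Jet m → ι → E} (hf : IsLocal f) (p : Jet m) (j : ι) :
    Dx f p j = Dx (fun q => f q j) p :=
  (congrFun (Dx_clm (ContinuousLinearMap.proj (R := ℝ) (φ := fun _ : ι => E) j) hf) p).symm

/-- The projection of the quaternions onto the imaginary quaternions. -/
def imCLM : ℍ[ℝ] →L[ℝ] ImQ := LinearMap.toContinuousLinearMap
  { toFun := fun a => ⟨a.im, rfl⟩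
    map_add' := fun a b => Subtype.ext (by ext <;> simp)
    map_smul' := fun r a => Subtype.ext (by ext <;> simp) }

theorem imCLM_coe (a : ImQ) : imCLM (a : ℍ[ℝ]) = a := by
  have hre : (a : ℍ[ℝ]).re = 0 := a.2
  refine Subtype.ext ?_
  change (a : ℍ[ℝ]).im = a
  ext <;> simp [hre]

theorem exists_kMat_eq_evenMat {f : Jet m → Val m} {a : localRing m} {v : Fin m → localRing m}
    (ha : ∀ p, a.1 p = (f p).1) (hv : ∀ p j, (v j).1 p = (f p).2 j) :
    ∃ hf : IsLocal f, kMat a v = evenMat hf := by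
  have hf : (fun p => (imCLM (a.1 p), fun j => (v j).1 p)) = f :=
    funext fun p => Prod.ext (by rw [ha, imCLM_coe]) (funext fun j => hv p j)
  have hlocal : IsLocal f := hf ▸ (a.2.clm imCLM).prodMk (isLocal_pi fun j => (v j).2)
  refine ⟨hlocal, ?_⟩
  rw [evenMat, show a = scalPart hlocal from localRing_ext ha,
    show v = vecPart hlocal from funext fun j => localRing_ext fun p => hv p j]

theorem totalHom_smul (c : ℝ) (f : localRing m) : totalHom m (c • f) = c • totalHom m f :=
  Subtype.ext (Dx_const_smul c f.2)

theorem totalHom_star (f : localRing m) : totalHom m (star f) = star (totalHom m f) :=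
  derivAlongHom_star _ f

theorem totalHom_scalPart_apply {w : Jet m → Val m} (hw : IsLocal w) (p : Jet m) :
    (totalHom m (scalPart hw)).1 p = (Dx (fun q => (w q).1) p : ImQ) :=
  (coe_Dx_imQ (hw.clm (ContinuousLinearMap.fst ℝ ImQ (QVec m))) p).symm

theorem totalHom_vecPart_apply {w : Jet m → Val m} (hw : IsLocal w) (j : Fin m) (p : Jet m) :
    (totalHom m (vecPart hw j)).1 p = Dx (fun q => (w q).2) p j :=
  (Dx_pi_apply (hw.clm (ContinuousLinearMap.snd ℝ ImQ (QVec m))) p j).symm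

theorem DomH.isLocal {w : Jet m → Val m} (hw : DomH w) : IsLocal w := hw.1

theorem DomJ.isLocal {h : Jet m → Val m} (hh : DomJ h) : IsLocal h := hh.1

theorem IsLocal.entry {S : Jet m → Fin m → Fin m → ℍ[ℝ]} (hS : IsLocal S) (i j : Fin m) :
    IsLocal (fun p => S p i j) :=
  (hS.clm (ContinuousLinearMap.proj (R := ℝ) (φ := fun _ : Fin m => Fin m → ℍ[ℝ]) i)).clm
    (ContinuousLinearMap.proj (R := ℝ) (φ := fun _ : Fin m => ℍ[ℝ]) j)

theorem Dx_entry {S : Jet m → Fin m → Fin m → ℍ[ℝ]} (hS : IsLocal S) (i j : Fin m) (p : Jet m) :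
    Dx (fun q => S q i j) p = Dx S p i j := by
  rw [Dx_pi_apply hS]
  exact (Dx_pi_apply
    (hS.clm (ContinuousLinearMap.proj (R := ℝ) (φ := fun _ : Fin m => Fin m → ℍ[ℝ]) i)) p j).symm

/-- The function `-w∥`, the scalar part of the compensating block of `evenLax`. -/
def parScal {w : Jet m → Val m} (hw : DomH w) : localRing m :=
  ⟨fun p => (DxInv (scalarCurr w) p : ImQ), hw.2.1.DxInv_spec.1.clm ImQ.subtypeL⟩

/-- The entries of `-𝐖∥`, the matrix part of the compensating block of `evenLax`. -/
def parEntry {w : Jet m → Val m} (hw : DomH w) (i j : Fin m) : localRing m :=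
  ⟨fun p => -DxInv (matrixCurr w) p i j, (hw.2.2.DxInv_spec.1.entry i j).neg⟩

/-- The even matrix of `(w, 𝐰)` together with the block of the nonlocal terms `w∥`, `𝐖∥`. -/
def evenLax {w : Jet m → Val m} (hw : DomH w) : LMat m :=
  evenMat hw.isLocal + parMat (parScal hw) (parEntry hw)

@[simp] theorem parScal_apply {w : Jet m → Val m} (hw : DomH w) (p : Jet m) :
    (parScal hw).1 p = (DxInv (scalarCurr w) p : ImQ) := rfl

@[simp] theorem parEntry_apply {w : Jet m → Val m} (hw : DomH w) (i j : Fin m) (p : Jet m) :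
    (parEntry hw i j).1 p = -DxInv (matrixCurr w) p i j := rfl

theorem totalHom_parScal_apply {w : Jet m → Val m} (hw : DomH w) (p : Jet m) :
    (totalHom m (parScal hw)).1 p = (scalarCurr w p : ImQ) := by
  obtain ⟨hlocal, hDx, -⟩ := hw.2.1.DxInv_spec
  exact (coe_Dx_imQ hlocal p).symm.trans (by rw [hDx])

theorem totalHom_parEntry_apply {w : Jet m → Val m} (hw : DomH w) (i j : Fin m) (p : Jet m) :
    (totalHom m (parEntry hw i j)).1 p = -matrixCurr w p i j := by
  obtain ⟨hlocal, hDx, -⟩ := hw.2.2.DxInv_spec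
  refine (congrFun (Dx_neg (hlocal.entry i j)) p).trans ?_
  rw [Dx_entry hlocal, hDx]

theorem star_parScal {w : Jet m → Val m} (hw : DomH w) : star (parScal hw) = -parScal hw :=
  localRing_ext fun _ => star_coe_imQ _

theorem star_parEntry {w : Jet m → Val m} (hw : DomH w) (i j : Fin m) :
    star (parEntry hw i j) = -parEntry hw j i := by
  refine Subtype.ext (eq_of_Dx_eq (star (parEntry hw i j)).2 (-parEntry hw j i).2 ?_ ?_)
  · have hstar : totalHom m (star (parEntry hw i j)) = totalHom m (-parEntry hw j i) := by
      refine localRing_ext fun p => ?_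
      rw [totalHom_star, map_neg]
      simp [totalHom_parEntry_apply, matrixCurr, commM]
    exact congrArg Subtype.val hstar
  · simp [hw.2.2.DxInv_spec.2.2]

theorem covD_evenLax {w : Jet m → Val m} (hw : DomH w) :
    ∃ hH : IsLocal (opH w), covD m (evenLax hw) = evenMat hH := by
  have hcov := mapMatrix_sub_lie_kMat (D := totalHom m) totalHom_star
    (star_scalPart (isLocal_uFun m)) (star_scalPart hw.isLocal) (star_parScal hw)
    (U := vecPart (isLocal_uFun m)) (Z := vecPart hw.isLocal) (star_parEntry hw)
    (localRing_ext fun p => by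
      simp [totalHom_parScal_apply, scalarCurr, commQ, commV, herm, uFun])
    (fun i j => localRing_ext fun p => by
      simp [totalHom_parEntry_apply, matrixCurr, commM, uFun])
  refine ((exists_kMat_eq_evenMat fun p => ?_) fun p j => ?_).imp fun _ => hcov.trans
  · simp only [one_div, AddMemClass.coe_add, AddSubgroupClass.coe_sub, MulMemClass.coe_mul,
      SetLike.val_smul, AddSubmonoidClass.coe_finsetSum, Pi.add_apply, Pi.sub_apply,
      totalHom_scalPart_apply, Pi.mul_apply, scalPart_apply, uFun, parScal_apply, Pi.smul_apply,
      Finset.sum_apply, vecPart_apply, star_localRing_apply, opH, commQ, wPar,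
      NegMemClass.coe_neg, mul_neg, neg_mul, sub_neg_eq_add, commV, herm, SetLike.mk_smul_mk,
      add_left_inj]
    abel
  · simp [opH, leftMul, vecMat, uFun, wPar, WPar, totalHom_vecPart_apply]

/-- The function `h∥` with values in the quaternions. -/
def hParHom {h : Jet m → Val m} (hh : DomJ h) : localRing m :=
  ⟨fun p => (hPar h p : ℍ[ℝ]), hh.2.DxInv_spec.1.clm (algebraMapCLM ℝ ℍ[ℝ])⟩

@[simp] theorem hParHom_apply {h : Jet m → Val m} (hh : DomJ h) (p : Jet m) :
    (hParHom hh).1 p = (hPar h p : ℍ[ℝ]) := rfl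

/-- The pair `(h, 𝐡)` as an element of the odd part of the Lie algebra, normalized so that its
bracket with the Cartan element is `evenMat`. -/
def oddMat {h : Jet m → Val m} (hh : IsLocal h) : LMat m :=
  mMat ((1 / 2 : ℝ) • scalPart hh) (vecPart hh)

/-- The odd matrix of `(h, 𝐡)` together with the Cartan term of the nonlocal function `h∥`. -/
def oddLax {h : Jet m → Val m} (hh : DomJ h) : LMat m :=
  oddMat hh.isLocal + rhoMat (hParHom hh)

theorem coe_realCurr {h : Jet m → Val m} (hh : IsLocal h) (p : Jet m) :
    ((realCurr h p : ℝ) : ℍ[ℝ]) = (-(scalPart (isLocal_uFun m) * ((1 / 2 : ℝ) • scalPart hh) +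
        ((1 / 2 : ℝ) • scalPart hh) * scalPart (isLocal_uFun m)) +
      (1 / 2 : ℝ) • (∑ i, vecPart (isLocal_uFun m) i * star (vecPart hh i) +
        ∑ i, vecPart hh i * star (vecPart (isLocal_uFun m) i))).1 p := by
  have hcoe : ((realCurr h p : ℝ) : ℍ[ℝ]) = (1 / 2 : ℝ) •
      (-((antiQ (p.2 0).1 (h p).1 : ℝ) : ℍ[ℝ]) + ((antiV (p.2 0).2 (h p).2 : ℝ) : ℍ[ℝ])) := by
    rw [realCurr, ← Quaternion.coe_neg, ← Quaternion.coe_add, Quaternion.smul_coe]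
  rw [hcoe, coe_antiQ, coe_antiV]
  simp [herm, uFun]

theorem totalHom_hParHom_apply {h : Jet m → Val m} (hh : DomJ h) (p : Jet m) :
    (totalHom m (hParHom hh)).1 p = (realCurr h p : ℍ[ℝ]) := by
  obtain ⟨hlocal, hDx, -⟩ := hh.2.DxInv_spec
  exact (congrFun (Dx_clm (algebraMapCLM ℝ ℍ[ℝ]) hlocal) p).trans (by rw [hDx]; rfl)

theorem eMat_lie_oddMat {h : Jet m → Val m} (hh : IsLocal h) :
    ⁅(eMat : LMat m), oddMat hh⁆ = evenMat hh := by
  rw [oddMat, eMat_lie_mMat, evenMat]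
  congr 1
  module

theorem eMat_lie_oddLax {h : Jet m → Val m} (hh : DomJ h) :
    ⁅(eMat : LMat m), oddLax hh⁆ = evenMat hh.isLocal := by
  rw [oddLax, lie_add, eMat_lie_oddMat, eMat_lie_rhoMat, add_zero]

theorem opJ_eq_evenMat {h : Jet m → Val m} (hh : DomJ h) :
    ∃ hJ : IsLocal (opJ h), kMat ((1 / 4 : ℝ) • totalHom m (scalPart hh.isLocal) +
        (1 / 4 : ℝ) • (∑ i, vecPart (isLocal_uFun m) i * star (vecPart hh.isLocal i) -
          ∑ i, vecPart hh.isLocal i * star (vecPart (isLocal_uFun m) i)) +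
        hParHom hh * scalPart (isLocal_uFun m))
      (fun j => totalHom m (vecPart hh.isLocal j) +
        (1 / 2 : ℝ) • scalPart hh.isLocal * vecPart (isLocal_uFun m) j +
        scalPart (isLocal_uFun m) * vecPart hh.isLocal j +
        hParHom hh * vecPart (isLocal_uFun m) j) = evenMat hJ :=
  exists_kMat_eq_evenMat
    (fun p => by
      simp [opJ, commV, herm, uFun, totalHom_scalPart_apply, Quaternion.coe_mul_eq_smul])
    (fun p j => by
      simp [opJ, leftMul, uFun, totalHom_vecPart_apply, Quaternion.coe_mul_eq_smul])

theorem covD_oddLax {h : Jet m → Val m} (hh : DomJ h) :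
    ∃ hJ : IsLocal (opJ h), covD m (oddLax hh) = ⁅(eMat : LMat m), evenMat hJ⁆ := by
  have hcov := mapMatrix_sub_lie_mMat (D := totalHom m) totalHom_star
    (star_scalPart (isLocal_uFun m)) (s := (1 / 2 : ℝ) • scalPart hh.isLocal) (ρ := hParHom hh)
    (localRing_ext fun p => by simp [star_coe_imQ])
    (U := vecPart (isLocal_uFun m)) (Z := vecPart hh.isLocal)
    (localRing_ext fun p => by simp)
    (localRing_ext fun p => by simpa using Quaternion.coe_commutes (hPar h p) _)
    (localRing_ext fun p => by rw [totalHom_hParHom_apply, coe_realCurr hh.isLocal])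
  refine (opJ_eq_evenMat hh).imp fun _ hJ => hcov.trans ?_
  rw [← hJ, eMat_lie_kMat]
  congr 1
  rw [totalHom_smul]
  module

theorem opH_skew {w v : Jet m → Val m} (hw : DomH w) (hv : DomH v) :
    IsTotalDeriv (fun p => pairing (opH w) v p + pairing w (opH v) p) := by
  obtain ⟨hHw, hcovw⟩ := covD_evenLax hw
  obtain ⟨hHv, hcovv⟩ := covD_evenLax hv
  have hleft : reTrace m (covD m (evenLax hw) * evenLax hv) =
      reTrace m (evenMat hHw * evenMat hv.isLocal) := by
    rw [hcovw, evenLax, mul_add, map_add, evenMat, reTrace_kMat_mul_parMat, add_zero]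
  have hright : reTrace m (evenLax hw * covD m (evenLax hv)) =
      reTrace m (evenMat hw.isLocal * evenMat hHv) := by
    rw [hcovv, evenLax, add_mul, map_add, reTrace_mul_comm (parMat _ _), evenMat, evenMat,
      reTrace_kMat_mul_parMat, add_zero]
  have htotal := (isTotalDeriv_reTrace_covD (evenLax hw) (evenLax hv)).const_smul (-1 / 2)
  rw [hleft, hright] at htotal
  convert htotal using 2 with p
  rw [reTrace_evenMat_mul_evenMat, reTrace_evenMat_mul_evenMat, smul_eq_mul]
  ring

theorem reTrace_lie_mul (X Y Z : LMat m) : reTrace m (⁅X, Y⁆ * Z) = -reTrace m (Y * ⁅X, Z⁆) := by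
  have hlie : ⁅X, Y * Z⁆ = ⁅X, Y⁆ * Z + Y * ⁅X, Z⁆ := isDerivation_innerDer X Y Z
  rw [eq_neg_iff_add_eq_zero, ← map_add, ← hlie, reTrace_lie]

theorem opJ_skew {f h : Jet m → Val m} (hf : DomJ f) (hh : DomJ h) :
    IsTotalDeriv (fun p => pairing (opJ f) h p + pairing f (opJ h) p) := by
  obtain ⟨hJf, hcovf⟩ := covD_oddLax hf
  obtain ⟨hJh, hcovh⟩ := covD_oddLax hh
  have hleft : reTrace m (covD m (oddLax hf) * oddLax hh) =
      -reTrace m (evenMat hJf * evenMat hh.isLocal) := by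
    rw [hcovf, reTrace_lie_mul, eMat_lie_oddLax]
  have hright : reTrace m (oddLax hf * covD m (oddLax hh)) =
      -reTrace m (evenMat hf.isLocal * evenMat hJh) := by
    rw [hcovh, ← eMat_lie_oddLax hf, reTrace_lie_mul, neg_neg]
  have htotal := (isTotalDeriv_reTrace_covD (oddLax hf) (oddLax hh)).const_smul (1 / 2)
  rw [hleft, hright] at htotal
  convert htotal using 2 with p
  rw [Pi.neg_apply, Pi.neg_apply, reTrace_evenMat_mul_evenMat, reTrace_evenMat_mul_evenMat,
    smul_eq_mul]
  ring

theorem opR_adjoint {f g : Jet m → Val m} (hf : DomR f) (hg : DomRstar g) :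
    EqFunctional (pairing (opR f) g) (pairing f (opRstar g)) := by
  have hskew := (opH_skew hf.2 hg.1).add ((opJ_skew hf.1 hg.2).const_smul (-1))
  rw [EqFunctional]
  convert hskew using 2 with p
  simp only [opR, opRstar, smul_eq_mul]
  ring

end Operators

/-! ### Local solutions lie in the domains of the operators -/

section Compensation

variable {m : ℕ} {R : Type*} [Ring R] [StarRing R] {D : R →+ R} {u : R} {U Z : Fin m → R}
  {Y : Matrix (Idx m) (Idx m) R}

theorem deriv_entry_of_mapMatrix_sub_lie_eq {w q : R} {S : Fin m → Fin m → R}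
    (h : D.mapMatrix (kMat w Z + parMat q S) - ⁅kMat u U, kMat w Z + parMat q S⁆ =
      ⁅(eMat : Matrix (Idx m) (Idx m) R), Y⁆) (i j : Fin m) :
    D (S i j) = -(star (U i) * Z j - star (Z i) * U j) := by
  have hij := congrFun (congrFun h (some (some i))) (some (some j))
  simp only [Ring.lie_def, AddMonoidHom.mapMatrix_apply, Matrix.map_apply, Matrix.mul_apply,
    Matrix.add_apply, Matrix.sub_apply, Fintype.sum_option, kMat, parMat, eMat, rhoMat,
    add_zero, zero_add, mul_zero, zero_mul, Finset.sum_const_zero, neg_mul, sub_self] at hij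
  rw [sub_eq_zero.1 hij]
  abel

variable [Algebra ℝ R]

theorem deriv_scal_of_mapMatrix_sub_lie_eq {w q : R} {S : Fin m → Fin m → R}
    (h : D.mapMatrix (kMat w Z + parMat q S) - ⁅kMat u U, kMat w Z + parMat q S⁆ =
      ⁅(eMat : Matrix (Idx m) (Idx m) R), Y⁆) :
    D q = u * w - w * u - (1 / 2 : ℝ) • (∑ i, U i * star (Z i) - ∑ i, Z i * star (U i)) := by
  have h₀ := congrFun (congrFun h none) none
  have h₁ := congrFun (congrFun h (some none)) (some none)
  simp only [Ring.lie_def, AddMonoidHom.mapMatrix_apply, Matrix.map_apply, Matrix.mul_apply,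
    Matrix.add_apply, Matrix.sub_apply, Fintype.sum_option, kMat, parMat, eMat, rhoMat, map_add,
    map_neg, add_zero, zero_add, mul_zero, zero_mul, Finset.sum_const_zero, mul_add, one_mul,
    mul_one, add_mul, mul_neg, neg_mul, Finset.sum_neg_distrib] at h₀ h₁
  have hdouble : (2 : ℝ) • D q = (2 : ℝ) • (u * w - w * u) -
      (∑ i, U i * star (Z i) - ∑ i, Z i * star (U i)) := by
    rw [← sub_eq_zero, ← sub_eq_zero.2 (congrArg₂ (· + ·) h₀ h₁)]
    module
  calc D q = (1 / 2 : ℝ) • (2 : ℝ) • D q := by module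
    _ = _ := by rw [hdouble]; module

theorem deriv_rho_of_mapMatrix_sub_lie_eq {s ρ : R} (hρu : Commute ρ u)
    (h : D.mapMatrix (mMat s Z + rhoMat ρ) - ⁅kMat u U, mMat s Z + rhoMat ρ⁆ =
      ⁅(eMat : Matrix (Idx m) (Idx m) R), Y⁆) :
    D ρ = -(u * s + s * u) +
      (1 / 2 : ℝ) • (∑ i, U i * star (Z i) + ∑ i, Z i * star (U i)) := by
  have h₀ := congrFun (congrFun h none) (some none)
  have h₁ := congrFun (congrFun h (some none)) none
  simp only [Ring.lie_def, AddMonoidHom.mapMatrix_apply, Matrix.map_apply, Matrix.mul_apply,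
    Matrix.add_apply, Matrix.sub_apply, Fintype.sum_option, kMat, mMat, eMat, rhoMat, map_add,
    map_neg, add_zero, zero_add, mul_zero, zero_mul, Finset.sum_const_zero, mul_add, one_mul,
    mul_one, add_mul, mul_neg, neg_mul, Finset.sum_neg_distrib, hρu.eq] at h₀ h₁
  have hdouble : (2 : ℝ) • D ρ = (2 : ℝ) • -(u * s + s * u) +
      (∑ i, U i * star (Z i) + ∑ i, Z i * star (U i)) := by
    rw [← sub_eq_zero, ← sub_eq_zero.2 (congrArg₂ (· + ·) h₀ h₁)]
    module
  calc D ρ = (1 / 2 : ℝ) • (2 : ℝ) • D ρ := by module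
    _ = _ := by rw [hdouble]; module

end Compensation

section Domains

variable {m : ℕ}

theorem eq_zero_of_neg_add_eq_zero_of_add_eq_zero {A : Type*} [AddCommGroup A] [Module ℝ A]
    {a b : A} (h₁ : -a + b = 0) (h₂ : a + b = 0) : b = 0 := by
  calc b = (1 / 2 : ℝ) • ((-a + b) + (a + b)) := by module
    _ = 0 := by rw [h₁, h₂, add_zero, smul_zero]

theorem imCLM_apply_of_star_eq_neg {q : localRing m} (hq : star q = -q) (p : Jet m) :
    ((imCLM (q.1 p) : ImQ) : ℍ[ℝ]) = q.1 p := by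
  have hp : star (q.1 p) = -q.1 p := congrFun (congrArg Subtype.val hq) p
  have hre : (q.1 p).re = 0 := Quaternion.star_eq_neg.1 hp
  exact congrArg Subtype.val (imCLM_coe ⟨q.1 p, hre⟩)

theorem coe_re_apply_of_star_eq {ρ : localRing m} (hρ : star ρ = ρ) (p : Jet m) :
    (((ρ.1 p).re : ℝ) : ℍ[ℝ]) = ρ.1 p :=
  (Quaternion.star_eq_self.1 (congrFun (congrArg Subtype.val hρ) p)).symm

theorem Dx_imCLM_eq_scalarCurr {w : Jet m → Val m} (hw : IsLocal w) {q : localRing m}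
    (hq : star q = -q)
    (hDq : totalHom m q = scalPart (isLocal_uFun m) * scalPart hw -
      scalPart hw * scalPart (isLocal_uFun m) -
      (1 / 2 : ℝ) • (∑ i, vecPart (isLocal_uFun m) i * star (vecPart hw i) -
        ∑ i, vecPart hw i * star (vecPart (isLocal_uFun m) i))) :
    Dx (fun p => imCLM (q.1 p)) = scalarCurr w := by
  funext p
  refine Subtype.ext ?_
  rw [coe_Dx_imQ (q.2.clm imCLM)]
  simp only [imCLM_apply_of_star_eq_neg hq]
  refine (congrFun (congrArg Subtype.val hDq) p).trans ?_
  simp [scalarCurr, commQ, commV, herm, uFun]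

theorem Dx_neg_entries_eq_matrixCurr {w : Jet m → Val m} (hw : IsLocal w)
    {S : Fin m → Fin m → localRing m}
    (hDS : ∀ i j, totalHom m (S i j) = -(star (vecPart (isLocal_uFun m) i) * vecPart hw j -
      star (vecPart hw i) * vecPart (isLocal_uFun m) j)) :
    IsLocal (fun p i j => -(S i j).1 p) ∧ Dx (fun p i j => -(S i j).1 p) = matrixCurr w := by
  have hlocal : IsLocal (fun p i j => -(S i j).1 p) :=
    isLocal_pi fun i => isLocal_pi fun j => (S i j).2.neg
  refine ⟨hlocal, ?_⟩
  funext p i j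
  rw [← Dx_entry hlocal, Dx_neg (S i j).2]
  refine (congrArg Neg.neg (congrFun (congrArg Subtype.val (hDS i j)) p)).trans ?_
  simp [matrixCurr, commM, uFun]

theorem Dx_re_eq_realCurr {h : Jet m → Val m} (hh : IsLocal h) {ρ : localRing m}
    (hDρ : totalHom m ρ = -(scalPart (isLocal_uFun m) * ((1 / 2 : ℝ) • scalPart hh) +
        ((1 / 2 : ℝ) • scalPart hh) * scalPart (isLocal_uFun m)) +
      (1 / 2 : ℝ) • (∑ i, vecPart (isLocal_uFun m) i * star (vecPart hh i) +
        ∑ i, vecPart hh i * star (vecPart (isLocal_uFun m) i))) :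
    Dx (fun p => (ρ.1 p).re) = realCurr h := by
  refine (Dx_clm reCLM ρ.2).trans (funext fun p => ?_)
  refine (congrArg reCLM (congrFun (congrArg Subtype.val hDρ) p)).trans ?_
  rw [← coe_realCurr hh]
  exact Quaternion.re_coe _

theorem exists_eq_evenLax {w : Jet m → Val m} (hw : IsLocal w) {X Y : LMat m}
    (hσ : sigConj X = X) (hstar : star X = -X) (h0 : ∀ i j, (X i j).1 0 = 0)
    (he : ⁅(eMat : LMat m), X⁆ = ⁅(eMat : LMat m), evenMat hw⁆)
    (hcov : covD m X = ⁅(eMat : LMat m), Y⁆) : ∃ hd : DomH w, X = evenLax hd := by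
  obtain ⟨q, S, hq, -, rfl⟩ := eq_kMat_add_parMat hσ hstar (star_scalPart hw)
    (he.trans (eMat_lie_kMat _ _))
  have hq0 : q.1 0 = 0 :=
    eq_zero_of_neg_add_eq_zero_of_add_eq_zero (h0 none none) (h0 (some none) (some none))
  have hS0 (i j) : (S i j).1 0 = 0 := by
    simpa [kMat, parMat] using h0 (some (some i)) (some (some j))
  have hDq := Dx_imCLM_eq_scalarCurr hw hq (deriv_scal_of_mapMatrix_sub_lie_eq hcov)
  obtain ⟨hSlocal, hDS⟩ :=
    Dx_neg_entries_eq_matrixCurr hw (deriv_entry_of_mapMatrix_sub_lie_eq hcov)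
  have hd : DomH w := ⟨hw, ⟨_, q.2.clm imCLM, hDq⟩, ⟨_, hSlocal, hDS⟩⟩
  have hqeq : q = parScal hd := localRing_ext fun p => by
    rw [parScal_apply, DxInv_eq (q.2.clm imCLM) hDq (by rw [hq0, map_zero]),
      imCLM_apply_of_star_eq_neg hq]
  have hSeq : S = parEntry hd := funext fun i => funext fun j => localRing_ext fun p => by
    rw [parEntry_apply, DxInv_eq hSlocal hDS (by funext i j; simp [hS0]), neg_neg]
  exact ⟨hd, by rw [hqeq, hSeq, evenLax, evenMat]⟩

theorem exists_eq_oddLax {h : Jet m → Val m} (hh : IsLocal h) {X Y : LMat m}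
    (hσ : sigConj X = -X) (hstar : star X = X) (h0 : ∀ i j, (X i j).1 0 = 0)
    (he : ⁅(eMat : LMat m), X⁆ = evenMat hh)
    (hcov : covD m X = ⁅(eMat : LMat m), Y⁆) : ∃ hd : DomJ h, X = oddLax hd := by
  obtain ⟨ρ, hρ, rfl⟩ := eq_mMat_add_rhoMat hσ hstar
    (a := (1 / 2 : ℝ) • scalPart hh) (v := vecPart hh)
    (localRing_ext fun p => by simp [star_coe_imQ])
    (by rw [he, ← eMat_lie_oddMat, oddMat, eMat_lie_mMat])
  have hρ0 : ρ.1 0 = 0 :=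
    eq_zero_of_neg_add_eq_zero_of_add_eq_zero (h0 (some none) none) (h0 none (some none))
  have hcomm : Commute ρ (scalPart (isLocal_uFun m)) := localRing_ext fun p => by
    change ρ.1 p * _ = _ * ρ.1 p
    rw [← coe_re_apply_of_star_eq hρ]
    exact Quaternion.coe_commutes _ _
  have hDρ := Dx_re_eq_realCurr hh (deriv_rho_of_mapMatrix_sub_lie_eq hcomm hcov)
  have hlocal : IsLocal (fun p => (ρ.1 p).re) := ρ.2.clm reCLM
  have hd : DomJ h := ⟨hh, ⟨_, hlocal, hDρ⟩⟩
  have hρeq : ρ = hParHom hd := localRing_ext fun p => by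
    rw [hParHom_apply, hPar, DxInv_eq hlocal hDρ (by rw [hρ0, Quaternion.re_zero]),
      coe_re_apply_of_star_eq hρ]
  exact ⟨hd, by rw [hρeq, oddLax, oddMat]⟩

end Domains

/-! ### The Lax series of the hierarchy -/

section LaxSeries

variable {m : ℕ}

theorem totalMat_eMat : totalMat m eMat = 0 := mapMatrix_derivAlongHom_eMat _

theorem prolongMat_eMat {X : Jet m → Val m} (hX : IsLocal X) : prolongMat hX eMat = 0 :=
  mapMatrix_derivAlongHom_eMat _

theorem totalMat_sigMat : totalMat m sigMat = 0 := by
  have hone : totalHom m 1 = 0 := Subtype.ext (Dx_const 1)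
  apply matrix_ext_idx <;> simp [sigMat, totalMat, hone, Matrix.diagonal_apply, apply_ite]

theorem sigConj_totalMat (X : LMat m) : sigConj (totalMat m X) = totalMat m (sigConj X) := by
  simp only [sigConj_apply, isDerivation_totalMat.map_mul, totalMat_sigMat, zero_mul, mul_zero,
    zero_add, add_zero]

theorem star_totalMat (X : LMat m) : star (totalMat m X) = totalMat m (star X) :=
  Matrix.ext fun i j => (totalHom_star (X j i)).symm

/-- Restriction of a function to the jets of the zero function, the vanishing of which turns out to
fix all constants of integration. -/
def zeroJetHom (m : ℕ) : localRing m →+* localRing m where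
  toFun f := ⟨fun p => f.1 (p.1, 0), by
    obtain ⟨k, F, hF, hf⟩ := f.2
    exact ⟨0, fun q => F (q.1, 0), hF.comp (by fun_prop), fun p => hf _⟩⟩
  map_zero' := rfl
  map_one' := rfl
  map_add' _ _ := rfl
  map_mul' _ _ := rfl

theorem zeroJetHom_apply (f : localRing m) (p : Jet m) : (zeroJetHom m f).1 p = f.1 (p.1, 0) := rfl

theorem zeroJetHom_totalHom (f : localRing m) :
    zeroJetHom m (totalHom m f) = totalHom m (zeroJetHom m f) := by
  refine localRing_ext fun p => ?_
  simp only [zeroJetHom_apply, totalHom_apply, Dx, lineDeriv, Prod.fst_add, Prod.smul_fst]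
  congr! 3 with t
  ext k <;> simp

theorem zeroJetHom_mapMatrix_eMat : (zeroJetHom m).mapMatrix (eMat : LMat m) = eMat := by
  apply matrix_ext_idx <;> simp [eMat, rhoMat]

theorem zeroJetHom_mapMatrix_uMat : (zeroJetHom m).mapMatrix (uMat m) = 0 := by
  have hscal : zeroJetHom m (scalPart (isLocal_uFun m)) = 0 := rfl
  have hvec (j) : zeroJetHom m (vecPart (isLocal_uFun m) j) = 0 := rfl
  have hstar (j) : zeroJetHom m (star (vecPart (isLocal_uFun m) j)) = 0 :=
    localRing_ext fun _ => star_zero ℍ[ℝ]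
  apply matrix_ext_idx <;> simp [uMat, evenMat, kMat, hscal, hvec, hstar]

/-- The solution `e + V₁ z + V₂ z² + ⋯` of the Lax equation with potential `(u, 𝐮)`. -/
def hierarchySeries (m : ℕ) : (LMat m)⟦X⟧ :=
  (exists_isLaxSolution isDerivation_totalMat (uMat m) eMat_pow_three).choose

theorem isLaxSolution_hierarchySeries (m : ℕ) :
    IsLaxSolution (totalMat m) eMat (uMat m) (hierarchySeries m) :=
  (exists_isLaxSolution isDerivation_totalMat (uMat m) eMat_pow_three).choose_spec

theorem covD_coeff_hierarchySeries (m n : ℕ) : covD m (coeff n (hierarchySeries m)) =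
    ⁅(eMat : LMat m), coeff (n + 1) (hierarchySeries m)⁆ :=
  (isLaxSolution_hierarchySeries m).coeff_succ n

theorem sigConj_coeff_hierarchySeries (m n : ℕ) : sigConj (coeff n (hierarchySeries m)) =
    (-1 : ℤ) ^ (n + 1) • coeff n (hierarchySeries m) :=
  (isLaxSolution_hierarchySeries m).map_coeff_eq sigConj sigConj_totalMat sigConj_eMat
    (sigConj_kMat _ _) n

theorem star_coeff_hierarchySeries (m n : ℕ) : star (coeff n (hierarchySeries m)) =
    (-1 : ℤ) ^ n • coeff n (hierarchySeries m) :=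
  (isLaxSolution_hierarchySeries m).star_coeff_eq star_totalMat star_eMat
    (star_kMat (star_scalPart _) _) n

theorem coeff_succ_hierarchySeries_apply_zero (m n : ℕ) (i j : Idx m) :
    (coeff (n + 1) (hierarchySeries m) i j).1 0 = 0 := by
  have hzero := (isLaxSolution_hierarchySeries m).map_coeff_succ_eq_zero (D' := totalMat m)
    (zeroJetHom m).mapMatrix (fun X => Matrix.ext fun i j => zeroJetHom_totalHom (X i j))
    (by rw [zeroJetHom_mapMatrix_eMat, totalMat_eMat]) zeroJetHom_mapMatrix_uMat n
  exact congrFun (congrArg Subtype.val (congrFun (congrFun hzero i) j)) 0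

theorem exists_coeff_odd_eq_evenLax (l : ℕ) {w : Jet m → Val m} (hw : IsLocal w)
    (he : covD m (coeff (2 * l) (hierarchySeries m)) = ⁅(eMat : LMat m), evenMat hw⁆) :
    ∃ hd : DomH w, coeff (2 * l + 1) (hierarchySeries m) = evenLax hd := by
  have hσ := sigConj_coeff_hierarchySeries m (2 * l + 1)
  have hstar := star_coeff_hierarchySeries m (2 * l + 1)
  rw [(odd_two_mul_add_one l).add_one.neg_one_pow, one_smul] at hσ
  rw [(odd_two_mul_add_one l).neg_one_pow, neg_one_smul] at hstar
  exact exists_eq_evenLax hw hσ hstar (coeff_succ_hierarchySeries_apply_zero m _)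
    ((covD_coeff_hierarchySeries m _).symm.trans he) (covD_coeff_hierarchySeries m _)

theorem exists_coeff_even_eq_oddLax (l : ℕ) {h : Jet m → Val m} (hh : IsLocal h)
    (he : covD m (coeff (2 * l + 1) (hierarchySeries m)) = evenMat hh) :
    ∃ hd : DomJ h, coeff (2 * l + 2) (hierarchySeries m) = oddLax hd := by
  have hσ := sigConj_coeff_hierarchySeries m (2 * l + 2)
  have hstar := star_coeff_hierarchySeries m (2 * l + 2)
  have heven : Even (2 * l + 2) := (odd_two_mul_add_one l).add_one
  rw [heven.add_one.neg_one_pow, neg_one_smul] at hσ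
  rw [heven.neg_one_pow, one_smul] at hstar
  exact exists_eq_oddLax hh hσ hstar (coeff_succ_hierarchySeries_apply_zero m _)
    ((covD_coeff_hierarchySeries m _).symm.trans he) (covD_coeff_hierarchySeries m _)

end LaxSeries

section Recursion

theorem opH_uFun (m : ℕ) : opH (uFun m) = uxFun m := by
  have hscal : scalarCurr (uFun m) = fun _ => 0 := by
    funext p
    refine Subtype.ext ?_
    simp [scalarCurr, commQ, commV, uFun]
  have hmatrix : matrixCurr (uFun m) = fun _ => 0 := by
    funext p i j
    simp [matrixCurr, commM, uFun]
  have hwPar (p) : wPar (uFun m) p = 0 := by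
    rw [wPar, hscal, DxInv_eq (isLocal_const 0) (Dx_const 0) rfl, neg_zero]
  have hWPar : WPar (uFun m) = fun _ => 0 := by
    rw [WPar, hmatrix, DxInv_eq (isLocal_const 0) (Dx_const 0) rfl]
  have hDx (p) : Dx (uFun m) p = uxFun m p := lineDeriv_coord 0 p _
  have hfst (p : Jet m) : Dx (fun q : Jet m => (q.2 0).1) p = (uxFun m p).1 :=
    (congrFun (Dx_clm (ContinuousLinearMap.fst ℝ ImQ (QVec m)) (isLocal_uFun m)) p).trans
      (congrArg Prod.fst (hDx p))
  have hsnd (p : Jet m) : Dx (fun q : Jet m => (q.2 0).2) p = (uxFun m p).2 :=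
    (congrFun (Dx_clm (ContinuousLinearMap.snd ℝ ImQ (QVec m)) (isLocal_uFun m)) p).trans
      (congrArg Prod.snd (hDx p))
  funext p
  refine Prod.ext (Subtype.ext ?_) (funext fun j => ?_)
  · simp [opH, hfst, hwPar, commQ, commV, uFun]
  · simp [opH, hsnd, hwPar, hWPar, leftMul, vecMat, uFun]

theorem opR_hSeq (m l : ℕ) : opR (hSeq m l) = hSeq m (l + 1) :=
  (Function.iterate_succ_apply' _ _ _).symm

theorem opRstar_wSeq (m l : ℕ) : opRstar (wSeq m l) = wSeq m (l + 1) :=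
  (Function.iterate_succ_apply' _ _ _).symm

theorem opH_wSeq (m l : ℕ) : opH (wSeq m l) = hSeq m l := by
  induction l with
  | zero => exact opH_uFun m
  | succ l ih => rw [← opRstar_wSeq, ← opR_hSeq, ← ih, opRstar, opR]

theorem opJ_hSeq (m l : ℕ) : opJ (hSeq m l) = wSeq m (l + 1) := by
  rw [← opH_wSeq, ← opRstar_wSeq, opRstar]

theorem pairing_uFun {m : ℕ} (h : Jet m → Val m) : pairing (uFun m) h = realCurr h := by
  funext p
  have hherm : (herm (h p).2 (p.2 0).2).re = (herm (p.2 0).2 (h p).2).re := by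
    rw [← star_herm, Quaternion.re_star]
  simp only [pairing, rePair, realCurr, antiQ, antiV, uFun, star_coe_imQ, Quaternion.re_add, hherm,
    mul_neg, Quaternion.re_neg, re_mul_comm ((h p).1 : ℍ[ℝ])]
  ring

end Recursion

section Hierarchy

theorem exists_coeff_hierarchySeries_eq_hSeq (m l : ℕ)
    (hw : ∃ hd : DomH (wSeq m l), coeff (2 * l + 1) (hierarchySeries m) = evenLax hd) :
    ∃ hd : DomJ (hSeq m l), coeff (2 * l + 2) (hierarchySeries m) = oddLax hd := by
  obtain ⟨hd, hcoeff⟩ := hw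
  obtain ⟨hH, hcov⟩ := covD_evenLax hd
  rw [← opH_wSeq]
  exact exists_coeff_even_eq_oddLax l hH (hcoeff ▸ hcov)

theorem exists_coeff_hierarchySeries_eq_wSeq (m l : ℕ) :
    ∃ hd : DomH (wSeq m l), coeff (2 * l + 1) (hierarchySeries m) = evenLax hd := by
  induction l with
  | zero =>
    refine exists_coeff_odd_eq_evenLax 0 (isLocal_uFun m) ?_
    rw [mul_zero, (isLaxSolution_hierarchySeries m).coeff_zero, covD_apply, totalMat_eMat, zero_sub,
      lie_skew, uMat]
    rfl
  | succ l ih =>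
    obtain ⟨hd, hcoeff⟩ := exists_coeff_hierarchySeries_eq_hSeq m l ih
    obtain ⟨hJ, hcov⟩ := covD_oddLax hd
    rw [← opJ_hSeq]
    exact exists_coeff_odd_eq_evenLax (l + 1) hJ (hcoeff ▸ hcov)

theorem domH_wSeq (m l : ℕ) : DomH (wSeq m l) := (exists_coeff_hierarchySeries_eq_wSeq m l).1

theorem coeff_odd_hierarchySeries (m l : ℕ) :
    coeff (2 * l + 1) (hierarchySeries m) = evenLax (domH_wSeq m l) :=
  (exists_coeff_hierarchySeries_eq_wSeq m l).2

theorem domJ_hSeq (m l : ℕ) : DomJ (hSeq m l) :=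
  (exists_coeff_hierarchySeries_eq_hSeq m l (exists_coeff_hierarchySeries_eq_wSeq m l)).1

theorem coeff_even_hierarchySeries (m l : ℕ) :
    coeff (2 * l + 2) (hierarchySeries m) = oddLax (domJ_hSeq m l) :=
  (exists_coeff_hierarchySeries_eq_hSeq m l (exists_coeff_hierarchySeries_eq_wSeq m l)).2

theorem domR_hSeq (m l : ℕ) : DomR (hSeq m l) :=
  ⟨domJ_hSeq m l, opJ_hSeq m l ▸ domH_wSeq m (l + 1)⟩

theorem domRstar_wSeq (m l : ℕ) : DomRstar (wSeq m l) :=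
  ⟨domH_wSeq m l, (opH_wSeq m l).symm ▸ domJ_hSeq m l⟩

theorem prolong_hSeq_comm (m k l : ℕ) :
    prolong (hSeq m k) (hSeq m l) = prolong (hSeq m l) (hSeq m k) := by
  have hlocal (l) : IsLocal (hSeq m l) := (domJ_hSeq m l).isLocal
  have hlie (l) :
      ⁅(eMat : LMat m), coeff (2 * l + 2) (hierarchySeries m)⁆ = evenMat (hlocal l) := by
    rw [coeff_even_hierarchySeries, eMat_lie_oddLax]
  have hflow (l) : prolongMat (hlocal l) (uMat m) =
      ⁅(eMat : LMat m), coeff (2 * l + 2) (hierarchySeries m)⁆ :=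
    (prolongMat_uMat _).trans (hlie l).symm
  have hcoeff : prolongMat (hlocal k) (coeff (2 * l + 2) (hierarchySeries m)) =
      prolongMat (hlocal l) (coeff (2 * k + 2) (hierarchySeries m)) :=
    (isLaxSolution_hierarchySeries m).deriv_coeff_comm isDerivation_totalMat
      (isDerivation_prolongMat _) (isDerivation_prolongMat _) (totalMat_prolongMat _)
      (totalMat_prolongMat _) (prolongMat_eMat _) (prolongMat_eMat _) (hflow k) (hflow l)
  have hprolong (k l) : prolongMat (hlocal k) (evenMat (hlocal l)) =
      ⁅(eMat : LMat m), prolongMat (hlocal k) (coeff (2 * l + 2) (hierarchySeries m))⁆ := by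
    rw [← hlie, (isDerivation_prolongMat _).map_lie, prolongMat_eMat, zero_lie, zero_add]
  have heven : prolongMat (hlocal k) (evenMat (hlocal l)) =
      prolongMat (hlocal l) (evenMat (hlocal k)) := by
    rw [hprolong, hprolong, hcoeff]
  rw [prolongMat, prolongMat, prolongHom, prolongHom, mapMatrix_derivAlongHom_evenMat,
    mapMatrix_derivAlongHom_evenMat] at heven
  exact eq_of_evenMat_eq heven

end Hierarchy

/-! ### The Hamiltonians -/

section Hamiltonians

variable {m : ℕ}

theorem isTotalDeriv_pairing_uFun_hSeq (m l : ℕ) :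
    IsTotalDeriv (pairing (uFun m) (hSeq m l)) :=
  pairing_uFun (hSeq m l) ▸ (domJ_hSeq m l).2

theorem Ham_eq (m l : ℕ) : Ham m l = fun p => 1 / (1 + 2 * (l : ℝ)) * hPar (hSeq m l) p := by
  funext p
  rw [Ham, pairing_uFun, hPar]

theorem Ham_apply_eq_DxInv_anti (m l : ℕ) (p : Jet m) : Ham m l p = 1 / (2 + 4 * (l : ℝ)) *
    DxInv (fun q => -antiQ (q.2 0).1 (hSeq m l q).1 + antiV (q.2 0).2 (hSeq m l q).2) p := by
  have hanti : (fun q : Jet m => -antiQ (q.2 0).1 (hSeq m l q).1 +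
      antiV (q.2 0).2 (hSeq m l q).2) = fun q => (2 : ℝ) • realCurr (hSeq m l) q := by
    funext q
    rw [realCurr, smul_eq_mul]
    ring
  rw [hanti, DxInv_const_smul 2 (domJ_hSeq m l).2, Ham_eq, hPar]
  simp only [smul_eq_mul]
  field_simp
  ring

theorem isLocal_hPar {h : Jet m → Val m} (hh : DomJ h) : IsLocal (hPar h) := hh.2.DxInv_spec.1

theorem isLocal_Ham (m l : ℕ) : IsLocal (Ham m l) :=
  Ham_eq m l ▸ (isLocal_hPar (domJ_hSeq m l)).const_smul _

theorem reTrace_oddLax_mul_eMat {h : Jet m → Val m} (hh : DomJ h) :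
    reTrace m (oddLax hh * eMat) = fun p => 2 * hPar h p := by
  funext p
  rw [oddLax, oddMat, add_mul, map_add, reTrace_mMat_mul_eMat, zero_add, reTrace_rhoMat_mul_eMat,
    hParHom_apply, Quaternion.re_coe]

theorem reTrace_evenLax_mul_evenMat {w X : Jet m → Val m} (hw : DomH w) (hX : IsLocal X) :
    reTrace m (evenLax hw * evenMat hX) = fun p => -2 * pairing X w p := by
  funext p
  rw [evenLax, add_mul, map_add, reTrace_mul_comm (parMat _ _), evenMat, evenMat,
    reTrace_kMat_mul_parMat, add_zero]
  exact (reTrace_evenMat_mul_evenMat hw.isLocal hX p).trans (by rw [pairing_comm])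

theorem prolong_const_mul (c : ℝ) {f : Jet m → ℝ} (hf : IsLocal f) (X : Jet m → Val m) :
    prolong X (fun p => c * f p) = fun p => c * prolong X f p :=
  funext fun p => hf.lineDeriv_clm (c • ContinuousLinearMap.id ℝ ℝ) p _

theorem reTrace_prolongMat_coeff_mul_eMat {X : Jet m → Val m} (hX : IsLocal X) (l : ℕ) :
    reTrace m (prolongMat hX (coeff (2 * l + 2) (hierarchySeries m)) * eMat) =
      fun p => 2 * prolong X (hPar (hSeq m l)) p := by
  have hmul : prolongMat hX (coeff (2 * l + 2) (hierarchySeries m)) * eMat =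
      prolongMat hX (oddLax (domJ_hSeq m l) * eMat) := by
    rw [(isDerivation_prolongMat hX).map_mul, prolongMat_eMat, mul_zero, add_zero,
      coeff_even_hierarchySeries]
  rw [hmul, prolongMat, prolongHom, ← derivAlong_reTrace, reTrace_oddLax_mul_eMat]
  exact prolong_const_mul 2 (isLocal_hPar (domJ_hSeq m l)) X

theorem isVarDeriv_Ham (m l : ℕ) : IsVarDeriv (Ham m l) (wSeq m l) := by
  refine ⟨(domH_wSeq m l).isLocal, fun X hX => ?_⟩
  obtain ⟨g, hg⟩ := (isLaxSolution_hierarchySeries m).trace_identity reTrace_mul_comm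
    isDerivation_totalMat (isDerivation_prolongMat hX) (totalMat_prolongMat hX)
    (prolongMat_eMat hX) (2 * l + 1)
  rw [reTrace_prolongMat_coeff_mul_eMat hX, coeff_odd_hierarchySeries, prolongMat_uMat,
    reTrace_evenLax_mul_evenMat] at hg
  have htotal := (isTotalDeriv_reTrace g).const_smul (1 / (2 * (1 + 2 * (l : ℝ))))
  rw [← hg] at htotal
  rw [EqFunctional]
  convert htotal using 2 with p
  rw [Ham_eq, prolong_const_mul _ (isLocal_hPar (domJ_hSeq m l)), Pi.add_apply, Pi.smul_apply,
    nsmul_eq_mul, smul_eq_mul]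
  push_cast
  field_simp
  ring

theorem varDeriv_Ham (m l : ℕ) : varDeriv (Ham m l) = wSeq m l := (isVarDeriv_Ham m l).varDeriv_eq

theorem prolong_hSeq_eqFunctional_poisson (l : ℕ) {G : Jet m → ℝ} (hG : IsLocal G) :
    EqFunctional (prolong (hSeq m l) G) (poisson G (Ham m l)) := by
  rw [poisson, varDeriv_Ham, opH_wSeq, pairing_comm]
  exact (isVarDeriv_varDeriv hG).2 _ (domJ_hSeq m l).isLocal

end Hamiltonians

/-! ### Involutivity -/

section Involutivity

theorem pairing_wSeq_hSeq_succ (m k l : ℕ) :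
    EqFunctional (pairing (wSeq m k) (hSeq m (l + 1))) (pairing (wSeq m (k + 1)) (hSeq m l)) := by
  have hadj := opR_adjoint (domR_hSeq m l) (domRstar_wSeq m k)
  rwa [opR_hSeq, opRstar_wSeq, pairing_comm, pairing_comm (hSeq m l)] at hadj

theorem pairing_wSeq_hSeq_add (m k l j : ℕ) :
    EqFunctional (pairing (wSeq m k) (hSeq m (l + j))) (pairing (wSeq m (k + j)) (hSeq m l)) := by
  induction j generalizing k with
  | zero => exact EqFunctional.refl _
  | succ j ih =>
    have hshift := (pairing_wSeq_hSeq_succ m k (l + j)).trans (ih (k + 1))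
    rwa [Nat.add_right_comm k 1 j] at hshift

theorem pairing_wSeq_hSeq_skew (m k l : ℕ) :
    EqFunctional (pairing (wSeq m k) (hSeq m l)) (fun p => -pairing (wSeq m l) (hSeq m k) p) := by
  have hskew := opH_skew (domH_wSeq m k) (domH_wSeq m l)
  rw [opH_wSeq, opH_wSeq, pairing_comm (hSeq m k)] at hskew
  rw [EqFunctional]
  convert hskew using 2 with p
  ring

theorem pairing_wSeq_hSeq_of_le (m : ℕ) {k l : ℕ} (hkl : k ≤ l) :
    EqFunctional (pairing (wSeq m k) (hSeq m l)) (fun _ => 0) := by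
  obtain ⟨j, rfl⟩ := Nat.exists_eq_add_of_le hkl
  have hself := IsTotalDeriv.const_smul (1 / 2) ((pairing_wSeq_hSeq_add m k k j).trans
    (pairing_wSeq_hSeq_skew m (k + j) k))
  rw [EqFunctional]
  convert hself using 2 with p
  rw [smul_eq_mul]
  ring

theorem pairing_wSeq_hSeq (m k l : ℕ) :
    EqFunctional (pairing (wSeq m k) (hSeq m l)) (fun _ => 0) := by
  rcases le_total k l with hkl | hlk
  · exact pairing_wSeq_hSeq_of_le m hkl
  · simpa using (pairing_wSeq_hSeq_skew m k l).trans (pairing_wSeq_hSeq_of_le m hlk).neg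

end Involutivity

end

end QuatHierarchy

open QuatHierarchy in
theorem mainTheorem2 (m : ℕ) :
    -- `ℛ*` is the formal adjoint of `ℛ`
    (∀ f g : Jet m → Val m, DomR f → DomRstar g →
      EqFunctional (pairing (opR f) g) (pairing f (opRstar g))) ∧
    -- both hierarchies and the Hamiltonians are well defined on the jet space
    (∀ l : ℕ, DomR (hSeq m l) ∧ DomRstar (wSeq m l) ∧
      IsTotalDeriv (pairing (uFun m) (hSeq m l)) ∧ IsLocal (Ham m l)) ∧
    -- the vector fields commute
    (∀ k l : ℕ, prolong (hSeq m k) (hSeq m l) = prolong (hSeq m l) (hSeq m k)) ∧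
    -- they are Hamiltonian with Hamiltonians `Ham m l`
    (∀ (l : ℕ) (G : Jet m → ℝ), IsLocal G →
      IsVarDeriv G (varDeriv G) ∧
      EqFunctional (prolong (hSeq m l) G) (poisson G (Ham m l))) ∧
    -- the other expressions for the Hamiltonians
    (∀ (l : ℕ) (p : Jet m),
      Ham m l p = 1 / (2 + 4 * (l : ℝ)) *
        DxInv (fun q => -antiQ (q.2 0).1 (hSeq m l q).1 + antiV (q.2 0).2 (hSeq m l q).2) p ∧
      Ham m l p = 1 / (1 + 2 * (l : ℝ)) * hPar (hSeq m l) p) ∧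
    -- the variational derivatives of the Hamiltonians
    (∀ l : ℕ, IsVarDeriv (Ham m l) (wSeq m l) ∧ varDeriv (Ham m l) = wSeq m l) ∧
    -- involutivity
    (∀ k l : ℕ, EqFunctional (poisson (Ham m k) (Ham m l)) (fun _ => 0) ∧
      EqFunctional (pairing (wSeq m k) (opH (wSeq m l))) (fun _ => 0)) ∧
    -- duality of covector fields and Hamiltonian vector fields
    (∀ (l : ℕ) (X : Jet m → Val m), IsLocal X →
      EqFunctional (contract (wSeq m (l + 1)) X) (symp X (hSeq m l))) := by
  refine ⟨fun _ _ => opR_adjoint, fun l => ⟨domR_hSeq m l, domRstar_wSeq m l,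
    isTotalDeriv_pairing_uFun_hSeq m l, isLocal_Ham m l⟩, prolong_hSeq_comm m,
    fun l G hG => ⟨isVarDeriv_varDeriv hG, prolong_hSeq_eqFunctional_poisson l hG⟩,
    fun l p => ⟨Ham_apply_eq_DxInv_anti m l p, congrFun (Ham_eq m l) p⟩,
    fun l => ⟨isVarDeriv_Ham m l, varDeriv_Ham m l⟩, fun k l => ?_, fun l X _ => ?_⟩
  · rw [poisson, varDeriv_Ham, varDeriv_Ham, opH_wSeq]
    exact ⟨pairing_wSeq_hSeq m k l, pairing_wSeq_hSeq m k l⟩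
  · rw [contract, symp, opJ_hSeq]
    exact EqFunctional.refl _
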